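/- Let $(M,g)$ be a smooth, time-oriented Lorentzian manifold (Hausdorff, paracompact, signature $(-,+,\dots,+)$), let $d$ be a metric on $M$ inducing the manifold topology, and let $0<a<\infty$. A continuous curve $\gamma:J\to M$ on an interval $J\subset\mathbb{R}$ is called future directed causal if, for all $s<t$ in $J$ and every open set $U\supseteq\gamma([s,t])$, there is a piecewise smooth future directed causal curve in $U$ from $\gamma(s)$ to $\gamma(t)$ (possibly the trivial one, if $\gamma(s)=\gamma(t)$); past directed causal curves are defined by time duality, and a causal curve is a curve of one of the two kinds. For a causal curve $\gamma$ on $[s,t]$ its Lorentzian length $L(\gamma|_{[s,t]})\in[0,\infty]$ is the infimum, over all partitions $s=p_0\le\dots\le p_n=t$ and all open sets $U_j\supseteq\gamma([p_j,p_{j+1}])$, of $\sum_{j} d_{U_j}(\gamma(p_j),\gamma(p_{j+1}))$, where $d_U(x,y)$ is the supremum of the lengths $\int\sqrt{-g(\sigma',\sigma')}$ of the piecewise smooth future directed causal curves $\sigma$ in $U$ joining $x$ and $y$ (in either order); equivalently, it is the infimum of the lengths of the piecewise causal geodesics inscribed in $\gamma$ within convex normal neighbourhoods. For an arbitrary interval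 $J$, $L(\gamma|_J)=\sup\{L(\gamma|_{[s,t]}): s,t\in J,\ s<t\}$. Let $\gamma_i:[0,a)\to M$, $i\in\mathbb{N}$, be causal curves which converge, uniformly on compact subsets of $[0,a)$ with respect to $d$, to a causal curve $\gamma:[0,a)\to M$. Suppose that 1. the lengths $L(\gamma_i)$ are all finite and the sequence $(L(\gamma_i))_i$ is bounded above, and 2. there is $b>0$ such that for all $i\in\mathbb{N}$ and all $t_1,t_2\in[0,a)$, $$L(\gamma_i|_{[t_1,t_2]})\le b\,|t_2-t_1|\quad\text{and}\quad L(\gamma_i|_{[t_1,a)})\le b\,|a-t_1|.$$ Then there is a subsequence $(\gamma_{i_k})_k$ such that $L(\gamma)\ge\limsup_k L(\gamma_{i_k})$. Moreover, for any such subsequence, if $L(\gamma|_{[0,t]})=\lim_k L(\gamma_{i_k}|_{[0,t]})$ for all $t\in[0,a)$, then $L(\gamma)=\lim_k L(\gamma_{i_k})$. -/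

import Mathlib

open Set Filter Topology MeasureTheory
open scoped Manifold ContDiff ENNReal Bundle

noncomputable section

/-- A smooth Lorentzian metric on the manifold `M` modelled on `E`: a smooth section of symmetric
bilinear forms on the tangent spaces, each of signature `(-,+,…,+)`, that is, negative on some
vector and positive definite on the orthogonal complement of that vector. -/
structure LorentzianMetric (E : Type*) [NormedAddCommGroup E] [NormedSpace ℝ E]
    (M : Type*) [TopologicalSpace M] [ChartedSpace E M] [IsManifold 𝓘(ℝ, E) ∞ M] where
  /-- The bilinear form on each tangent space. -/
  inner (x : M) : TangentSpace 𝓘(ℝ, E) x →L[ℝ] TangentSpace 𝓘(ℝ, E) x →L[ℝ] ℝ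
  symm (x : M) (v w : TangentSpace 𝓘(ℝ, E) x) : inner x v w = inner x w v
  signature (x : M) : ∃ v : TangentSpace 𝓘(ℝ, E) x, inner x v v < 0 ∧
    ∀ w : TangentSpace 𝓘(ℝ, E) x, inner x v w = 0 → w ≠ 0 → 0 < inner x w w
  contMDiff : ContMDiff 𝓘(ℝ, E) (𝓘(ℝ, E).prod 𝓘(ℝ, E →L[ℝ] E →L[ℝ] ℝ)) ∞
    (fun x ↦ Bundle.TotalSpace.mk' (E →L[ℝ] E →L[ℝ] ℝ)
      (E := fun x : M ↦ TangentSpace 𝓘(ℝ, E) x →L[ℝ] TangentSpace 𝓘(ℝ, E) x →L[ℝ] ℝ)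
      x (inner x))

namespace LorentzianMetric

/-- A time orientation: a continuous timelike vector field, which points to the future. -/
structure TimeOrientation {E : Type*} [NormedAddCommGroup E] [NormedSpace ℝ E]
    {M : Type*} [TopologicalSpace M] [ChartedSpace E M] [IsManifold 𝓘(ℝ, E) ∞ M]
    (g : LorentzianMetric E M) where
  /-- The vector field. -/
  field (x : M) : TangentSpace 𝓘(ℝ, E) x
  timelike (x : M) : g.inner x (field x) (field x) < 0
  continuous : Continuous
    (fun x ↦ (Bundle.TotalSpace.mk' E x (field x) : TangentBundle 𝓘(ℝ, E) M))

variable {E : Type*} [NormedAddCommGroup E] [NormedSpace ℝ E]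
  {M : Type*} [TopologicalSpace M] [ChartedSpace E M] [IsManifold 𝓘(ℝ, E) ∞ M]
  {g : LorentzianMetric E M}

/-- The velocity at time `s` of an arc `σ` that is parametrised by `[0,1]`
(one-sided at the two ends). -/
def velocity (E : Type*) [NormedAddCommGroup E] [NormedSpace ℝ E]
    {M : Type*} [TopologicalSpace M] [ChartedSpace E M]
    (σ : ℝ → M) (s : ℝ) : TangentSpace 𝓘(ℝ, E) (σ s) :=
  mfderivWithin 𝓘(ℝ, ℝ) 𝓘(ℝ, E) σ (Icc 0 1) s (1 : ℝ)

/-- Future directed causal (timelike or null) nonzero tangent vectors. -/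
def TimeOrientation.IsFutureCausal (τ : g.TimeOrientation) (x : M)
    (v : TangentSpace 𝓘(ℝ, E) x) : Prop :=
  v ≠ 0 ∧ g.inner x v v ≤ 0 ∧ g.inner x (τ.field x) v ≤ 0

/-- `σ`, restricted to `[0,1]`, is a smooth future directed causal arc that stays in `U`. -/
def TimeOrientation.IsFutureArc (τ : g.TimeOrientation) (U : Set M) (σ : ℝ → M) : Prop :=
  ContMDiffOn 𝓘(ℝ, ℝ) 𝓘(ℝ, E) ∞ σ (Icc 0 1) ∧ MapsTo σ (Icc 0 1) U ∧
    ∀ s ∈ Icc (0 : ℝ) 1, τ.IsFutureCausal (σ s) (velocity E σ s)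

/-- The Lorentzian length `∫ √(-g(σ',σ'))` of a smooth arc parametrised by `[0,1]`. -/
def arcLength (g : LorentzianMetric E M) (σ : ℝ → M) : ℝ≥0∞ :=
  ∫⁻ s in Icc (0 : ℝ) 1,
    ENNReal.ofReal (Real.sqrt (-(g.inner (σ s) (velocity E σ s) (velocity E σ s))))

/-- `τ.Trip U x y ℓ`: there is a causal trip in `U` from `x` to `y` of Lorentzian length `ℓ`, i.e. a
finite concatenation of smooth future directed causal arcs in `U` (the trip without any arc, from a
point to itself, is included). -/
inductive TimeOrientation.Trip (τ : g.TimeOrientation) (U : Set M) : M → M → ℝ≥0∞ → Prop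
  | refl (x : M) (hx : x ∈ U) : τ.Trip U x x 0
  | cons (σ : ℝ → M) (z : M) (l : ℝ≥0∞) (hσ : τ.IsFutureArc U σ) (h : τ.Trip U (σ 1) z l) :
      τ.Trip U (σ 0) z (g.arcLength σ + l)

/-- A curve that is continuous on the interval `J` is *future directed causal* there if any two of
its points are joined by a future directed causal trip inside each open set that contains the
portion of the curve between them. -/
def TimeOrientation.IsFutureCausalCurve (τ : g.TimeOrientation) (γ : ℝ → M) (J : Set ℝ) : Prop :=
  ContinuousOn γ J ∧ ∀ s ∈ J, ∀ t ∈ J, s < t → ∀ U : Set M, IsOpen U → γ '' Icc s t ⊆ U →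
    ∃ l, τ.Trip U (γ s) (γ t) l

/-- The time dual notion. -/
def TimeOrientation.IsPastCausalCurve (τ : g.TimeOrientation) (γ : ℝ → M) (J : Set ℝ) : Prop :=
  ContinuousOn γ J ∧ ∀ s ∈ J, ∀ t ∈ J, s < t → ∀ U : Set M, IsOpen U → γ '' Icc s t ⊆ U →
    ∃ l, τ.Trip U (γ t) (γ s) l

/-- Continuous causal curves, future or past directed. -/
def TimeOrientation.IsCausalCurve (τ : g.TimeOrientation) (γ : ℝ → M) (J : Set ℝ) : Prop :=
  τ.IsFutureCausalCurve γ J ∨ τ.IsPastCausalCurve γ J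

/-- The supremum of the lengths of the causal trips in `U` with end points `x` and `y`, in either
order, so that future and past directed curves are treated alike. If `U` is a convex normal
neighbourhood this is the length of the causal geodesic in `U` between causally related points. -/
def TimeOrientation.separation (τ : g.TimeOrientation) (U : Set M) (x y : M) : ℝ≥0∞ :=
  ⨆ (l : ℝ≥0∞) (_ : τ.Trip U x y l ∨ τ.Trip U y x l), l

/-- The Lorentzian length of the causal curve `γ` on the compact interval `[s,t]`, with `s ≤ t`: the
infimum, over the partitions `s = p 0 ≤ p 1 ≤ … ≤ p n = t` and the open sets `U j` that contain the
`j`-th piece of the curve, of the sum of the separations in `U j` of consecutive points. Partitions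
into pieces in convex normal neighbourhoods suffice, so this is the infimum of the
lengths of the causal trips that are inscribed into the curve. -/
def TimeOrientation.lengthIcc (τ : g.TimeOrientation) (γ : ℝ → M) (s t : ℝ) : ℝ≥0∞ :=
  ⨅ (n : ℕ) (p : ℕ → ℝ) (U : ℕ → Set M)
    (_ : Monotone p ∧ p 0 = s ∧ p n = t ∧
      ∀ j < n, IsOpen (U j) ∧ γ '' Icc (p j) (p (j + 1)) ⊆ U j),
    ∑ j ∈ Finset.range n, τ.separation (U j) (γ (p j)) (γ (p (j + 1)))

/-- The Lorentzian length `L(γ|_J)` of a causal curve on an arbitrary interval `J`: the supremum of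
the lengths on the compact subintervals `[s,t]`, `s < t`. -/
def TimeOrientation.length (τ : g.TimeOrientation) (γ : ℝ → M) (J : Set ℝ) : ℝ≥0∞ :=
  ⨆ (s : ℝ) (_ : s ∈ J) (t : ℝ) (_ : t ∈ J) (_ : s < t), τ.lengthIcc γ s t

end LorentzianMetric

end

/-!
Half of the assertion holds for the whole sequence: the length is upper semicontinuous on each
compact interval (`TimeOrientation.IsDirectedCurve.limsup_lengthIcc_le`), and the bound
`b * (a - r)` for the lengths on `[r, a)` makes the remaining tails uniformly small. The reverse
inequality `L(γ) ≤ lim inf L(γ i)` needs only that `L(γ)` is the supremum of the lengths on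
compact intervals, which are limits by assumption.

Upper semicontinuity is proved without geodesics or convex normal neighbourhoods; continuity of
the metric suffices. In a chart, let `z` be a point near which the metric differs from its value
at `z` by at most `e`. There the causal cones lie in the cone of a constant Lorentzian form `q`,
the metric at `z` widened along a time form `f` (`wideMetric`). Since `√(-q v v)` is concave on the
causal cone of `q`, Jensen's inequality shows that no causal trip with displacement `D` is longer
than `√(-q D D)`. Conversely, if `D` is the displacement of some causal trip, then either the
straight line with displacement `D` is causal and has that length up to an error of order
`√e * f D`, or `√(-q D D)` itself is of that order. The two bounds are combined in
`TimeOrientation.exists_local_comparison`. The first one is continuous in the end points, so it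
passes to the limit curve, where the second one inserts causal trips. The errors add up to a small
multiple of the increment of the time function `f`, independently of the partition, as long as one
stays in one of finitely many charts; this is `TimeOrientation.IsDirectedCurve.tripBound`.
-/

namespace LorentzianMetric

/-! ### The metric in a chart -/

section Chart

variable {E : Type*} [NormedAddCommGroup E] [NormedSpace ℝ E]
  {M : Type*} [TopologicalSpace M] [ChartedSpace E M] [IsManifold 𝓘(ℝ, E) ∞ M]
  {g : LorentzianMetric E M}

/-- The coordinates, in the chart centred at `x₀`, of a tangent vector at `x`. -/
noncomputable def chartVector (E : Type*) [NormedAddCommGroup E] [NormedSpace ℝ E]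
    {M : Type*} [TopologicalSpace M] [ChartedSpace E M] [IsManifold 𝓘(ℝ, E) ∞ M]
    (x₀ x : M) : TangentSpace 𝓘(ℝ, E) x →L[ℝ] E :=
  (trivializationAt E (TangentSpace 𝓘(ℝ, E)) x₀).continuousLinearMapAt ℝ x

/-- The metric at `x` as a bilinear form on the model space, in the chart centred at `x₀`. -/
noncomputable def chartMetric (g : LorentzianMetric E M) (x₀ x : M) : E →L[ℝ] E →L[ℝ] ℝ :=
  let b : E →L[ℝ] E →L[ℝ] ℝ := g.inner x
  let e : E →L[ℝ] E := (trivializationAt E (TangentSpace 𝓘(ℝ, E)) x₀).symmL ℝ x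
  b.bilinearComp e e

lemma chartMetric_apply (g : LorentzianMetric E M) (x₀ x : M) (u v : E) :
    g.chartMetric x₀ x u v =
      g.inner x ((trivializationAt E (TangentSpace 𝓘(ℝ, E)) x₀).symmL ℝ x u)
        ((trivializationAt E (TangentSpace 𝓘(ℝ, E)) x₀).symmL ℝ x v) :=
  rfl

lemma chartMetric_symm (g : LorentzianMetric E M) (x₀ x : M) (u v : E) :
    g.chartMetric x₀ x u v = g.chartMetric x₀ x v u :=
  g.symm x _ _

lemma chartMetric_chartVector (g : LorentzianMetric E M) {x₀ x : M}
    (hx : x ∈ (chartAt E x₀).source) (v w : TangentSpace 𝓘(ℝ, E) x) :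
    g.chartMetric x₀ x (chartVector E x₀ x v) (chartVector E x₀ x w) = g.inner x v w := by
  have hx' : x ∈ (trivializationAt E (TangentSpace 𝓘(ℝ, E)) x₀).baseSet := by simpa using hx
  rw [chartMetric_apply, chartVector]
  rw [Bundle.Trivialization.symmL_continuousLinearMapAt _ hx',
    Bundle.Trivialization.symmL_continuousLinearMapAt _ hx']

lemma chartVector_eq_zero_iff {x₀ x : M} (hx : x ∈ (chartAt E x₀).source)
    (v : TangentSpace 𝓘(ℝ, E) x) : chartVector E x₀ x v = 0 ↔ v = 0 := by
  have hx' : x ∈ (trivializationAt E (TangentSpace 𝓘(ℝ, E)) x₀).baseSet := by simpa using hx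
  refine ⟨fun h ↦ ?_, fun h ↦ by rw [h, map_zero]⟩
  rw [← Bundle.Trivialization.symmL_continuousLinearMapAt (R := ℝ) _ hx' v]
  rw [chartVector] at h
  rw [h, map_zero]

lemma exists_chartVector_eq {x₀ x : M} (hx : x ∈ (chartAt E x₀).source) (u : E) :
    ∃ v : TangentSpace 𝓘(ℝ, E) x, chartVector E x₀ x v = u := by
  have hx' : x ∈ (trivializationAt E (TangentSpace 𝓘(ℝ, E)) x₀).baseSet := by simpa using hx
  exact ⟨_, Bundle.Trivialization.continuousLinearMapAt_symmL _ hx' u⟩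

lemma continuousOn_chartMetric [FiniteDimensional ℝ E] (g : LorentzianMetric E M) (x₀ : M) :
    ContinuousOn (g.chartMetric x₀) (chartAt E x₀).source := by
  refine continuousOn_clm_apply.2 fun u ↦ continuousOn_clm_apply.2 fun v ↦ ?_
  have hsec (w : E) : ContMDiffOn 𝓘(ℝ, E) (𝓘(ℝ, E).prod 𝓘(ℝ, E)) ∞
      (fun x ↦ Bundle.TotalSpace.mk' E (E := TangentSpace 𝓘(ℝ, E)) x
        ((trivializationAt E (TangentSpace 𝓘(ℝ, E)) x₀).symmL ℝ x w))
      (chartAt E x₀).source := by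
    have := (trivializationAt E (TangentSpace 𝓘(ℝ, E)) x₀).contMDiffOn_symm
      (IB := 𝓘(ℝ, E)) (n := ∞)
    have h2 := this.comp (f := fun x : M ↦ (x, w)) (s := (chartAt E x₀).source)
      (contMDiff_id.prodMk contMDiff_const).contMDiffOn (fun x hx ↦ by simpa using hx)
    refine h2.congr fun x hx ↦ ?_
    have hx' : x ∈ (trivializationAt E (TangentSpace 𝓘(ℝ, E)) x₀).baseSet := by simpa using hx
    rw [Bundle.Trivialization.symmL_apply _ hx']
    exact Bundle.Trivialization.mk_symm (trivializationAt E (TangentSpace 𝓘(ℝ, E)) x₀) hx' w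
  have h : ContMDiffOn 𝓘(ℝ, E) (𝓘(ℝ, E).prod 𝓘(ℝ)) ∞
      (fun x ↦ Bundle.TotalSpace.mk' ℝ (E := Bundle.Trivial M ℝ) x (g.chartMetric x₀ x u v))
      (chartAt E x₀).source :=
    ContMDiffOn.clm_bundle_apply₂ (F₁ := E) (F₂ := E) (E₁ := TangentSpace 𝓘(ℝ, E))
      (E₂ := TangentSpace 𝓘(ℝ, E)) (ψ := g.inner) g.contMDiff.contMDiffOn (hsec u) (hsec v)
  intro x hx
  have := h x hx
  simp only [Bundle.contMDiffWithinAt_totalSpace] at this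
  exact this.2.continuousWithinAt

lemma TimeOrientation.continuousOn_chartField (τ : g.TimeOrientation) (x₀ : M) :
    ContinuousOn (fun x ↦ chartVector E x₀ x (τ.field x)) (chartAt E x₀).source := by
  set e := trivializationAt E (TangentSpace 𝓘(ℝ, E)) x₀ with he
  have h : ContinuousOn (fun x ↦ (e ⟨x, τ.field x⟩).2) (chartAt E x₀).source := by
    refine continuous_snd.comp_continuousOn (e.continuousOn.comp τ.continuous.continuousOn ?_)
    intro x hx
    rw [e.mem_source]
    simpa [he] using hx
  refine h.congr fun x hx ↦ ?_
  have hx' : x ∈ e.baseSet := by simpa [he] using hx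
  simp only [chartVector]
  rw [Bundle.Trivialization.continuousLinearMapAt_apply, e.linearMapAt_apply, if_pos hx']

lemma contDiffOn_chart_comp {x₀ : M} {σ : ℝ → M}
    (hσ : ContMDiffOn 𝓘(ℝ, ℝ) 𝓘(ℝ, E) ∞ σ (Icc 0 1))
    (hs : MapsTo σ (Icc 0 1) (chartAt E x₀).source) :
    ContDiffOn ℝ ∞ (chartAt E x₀ ∘ σ) (Icc 0 1) := by
  rw [← contMDiffOn_iff_contDiffOn]
  exact (contMDiffOn_chart (I := 𝓘(ℝ, E)) (n := ∞)).comp hσ hs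

lemma hasDerivWithinAt_chart_comp {x₀ : M} {σ : ℝ → M}
    (hσ : ContMDiffOn 𝓘(ℝ, ℝ) 𝓘(ℝ, E) ∞ σ (Icc 0 1))
    (hs : MapsTo σ (Icc 0 1) (chartAt E x₀).source) {s : ℝ} (h : s ∈ Icc (0 : ℝ) 1) :
    HasDerivWithinAt (chartAt E x₀ ∘ σ) (chartVector E x₀ (σ s) (velocity E σ s)) (Icc 0 1) s := by
  have h1 : MDifferentiableAt 𝓘(ℝ, E) 𝓘(ℝ, E) (extChartAt 𝓘(ℝ, E) x₀) (σ s) :=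
    mdifferentiableAt_extChartAt (hs h)
  have h2 : MDifferentiableWithinAt 𝓘(ℝ, ℝ) 𝓘(ℝ, E) σ (Icc 0 1) s :=
    (hσ s h).mdifferentiableWithinAt (by simp)
  have h3 := h1.hasMFDerivAt.comp_hasMFDerivWithinAt s h2.hasMFDerivWithinAt
  let L : ℝ →L[ℝ] E := (mfderiv 𝓘(ℝ, E) 𝓘(ℝ, E) (extChartAt 𝓘(ℝ, E) x₀) (σ s)).comp
    (mfderivWithin 𝓘(ℝ, ℝ) 𝓘(ℝ, E) σ (Icc 0 1) s)
  have h4 : HasFDerivWithinAt (chartAt E x₀ ∘ σ) L (Icc 0 1) s :=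
    hasMFDerivWithinAt_iff_hasFDerivWithinAt.1 h3
  have h5 : chartVector E x₀ (σ s) (velocity E σ s) = L 1 := by
    rw [chartVector, TangentBundle.continuousLinearMapAt_trivializationAt (hs h)]
    rfl
  rw [h5]
  exact h4.hasDerivWithinAt

lemma derivWithin_chart_comp {x₀ : M} {σ : ℝ → M}
    (hσ : ContMDiffOn 𝓘(ℝ, ℝ) 𝓘(ℝ, E) ∞ σ (Icc 0 1))
    (hs : MapsTo σ (Icc 0 1) (chartAt E x₀).source) {s : ℝ} (h : s ∈ Icc (0 : ℝ) 1) :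
    chartVector E x₀ (σ s) (velocity E σ s) = derivWithin (chartAt E x₀ ∘ σ) (Icc 0 1) s :=
  ((hasDerivWithinAt_chart_comp hσ hs h).derivWithin (uniqueDiffOn_Icc_zero_one s h)).symm

end Chart

/-! ### Lorentzian forms -/

section LorentzianForm

variable {E : Type*} [NormedAddCommGroup E] [NormedSpace ℝ E]

/-- The orthogonal complement of every timelike vector of a Lorentzian form is spacelike. -/
lemma pos_of_orthogonal_timelike {β : E →L[ℝ] E →L[ℝ] ℝ} (hβ : ∀ u v, β u v = β v u)
    (hsig : ∃ v, β v v < 0 ∧ ∀ w, β v w = 0 → w ≠ 0 → 0 < β w w)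
    {T : E} (hT : β T T < 0) {u : E} (hu : β T u = 0) (hu0 : u ≠ 0) : 0 < β u u := by
  obtain ⟨v, -, hv⟩ := hsig
  by_contra! hneg
  have hvT : β v T ≠ 0 := fun h ↦ by
    have hT0 : T ≠ 0 := by rintro rfl; simp at hT
    exact (hv T h hT0).not_gt hT
  -- `z` lies in the plane of `T` and `u`, on which the form would be negative semidefinite
  set z := β v u • T - β v T • u with hz
  have hvz : β v z = 0 := by simp [hz]; ring
  have hTz : β T z = β v u * β T T := by simp [hz, hu]
  have hz0 : z ≠ 0 := by
    intro h0
    have h1 : β v u = 0 := by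
      rw [h0, map_zero] at hTz
      rcases mul_eq_zero.1 hTz.symm with h | h
      · exact h
      · exact absurd h hT.ne
    rw [hz, h1, zero_smul, zero_sub, neg_eq_zero] at h0
    exact (smul_ne_zero hvT hu0) h0
  have hzz : β z z = (β v u) ^ 2 * β T T + (β v T) ^ 2 * β u u := by
    simp [hz, hu, hβ u T]; ring
  have := hv z hvz hz0
  nlinarith [sq_nonneg (β v u), sq_nonneg (β v T)]

/-- A Lorentzian form becomes positive definite after adding a multiple of the square of the form
dual to a timelike vector. -/
lemma exists_pos_mul_norm_sq_le [FiniteDimensional ℝ E] {β : E →L[ℝ] E →L[ℝ] ℝ}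
    (hβ : ∀ u v, β u v = β v u)
    (hsig : ∃ v, β v v < 0 ∧ ∀ w, β v w = 0 → w ≠ 0 → 0 < β w w) {T : E} (hT : β T T < 0) :
    ∃ c > 0, ∃ r > 0, ∀ v, c * ‖v‖ ^ 2 ≤ β v v + r * (β T v) ^ 2 := by
  set m := -β T T with hm
  have hm0 : 0 < m := by linarith
  have hpos : ∀ v : E, v ≠ 0 → 0 < β v v + 2 / m * (β T v) ^ 2 := by
    intro v hv0
    set u := v + (β T v / m) • T with hu
    have hTu : β T u = 0 := by
      simp only [hu, map_add, map_smul, smul_eq_mul]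
      rw [show β T T = -m by simp [hm]]
      field_simp
      ring
    have huu : β u u = β v v + (β T v) ^ 2 / m := by
      simp only [hu, map_add, map_smul, smul_eq_mul, add_apply,
        smul_apply, hβ v T]
      rw [show β T T = -m by simp [hm]]
      field_simp
      ring
    have h1 : β v v + 2 / m * (β T v) ^ 2 = β u u + (β T v) ^ 2 / m := by
      rw [huu]; field_simp; ring
    rw [h1]
    by_cases h0 : u = 0
    · have : β T v ≠ 0 := by
        intro h
        rw [hu, h, zero_div, zero_smul, add_zero] at h0
        exact hv0 h0
      rw [h0]; simp only [map_zero, zero_add]; positivity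
    · have := pos_of_orthogonal_timelike hβ hsig hT hTu h0
      positivity
  have hT0 : T ≠ 0 := by rintro rfl; simp at hT
  have hcont : Continuous fun v : E ↦ β v v + 2 / m * (β T v) ^ 2 := by fun_prop
  have hne : (Metric.sphere (0 : E) 1).Nonempty :=
    ⟨‖T‖⁻¹ • T, by simp [norm_smul, hT0]⟩
  obtain ⟨w, hw, hmin⟩ := (isCompact_sphere (0 : E) 1).exists_isMinOn hne hcont.continuousOn
  have hw0 : w ≠ 0 := by rintro rfl; simp at hw
  refine ⟨_, hpos w hw0, 2 / m, by positivity, fun v ↦ ?_⟩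
  by_cases hv0 : v = 0
  · simp [hv0]
  have hn : ‖v‖ ≠ 0 := norm_ne_zero_iff.2 hv0
  have h2 := hmin (a := ‖v‖⁻¹ • v) (by simp [norm_smul, hn])
  simp only [mem_ofPred_eq, map_smul, smul_apply, smul_eq_mul] at h2
  calc _ ≤ (‖v‖⁻¹ * (‖v‖⁻¹ * β v v) + 2 / m * (‖v‖⁻¹ * β T v) ^ 2) * ‖v‖ ^ 2 := by gcongr
    _ = _ := by field_simp

/-- The reversed Cauchy–Schwarz inequality. -/
lemma sqrt_mul_sqrt_le_neg {q : E →L[ℝ] E →L[ℝ] ℝ} {f : E →L[ℝ] ℝ}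
    (hq : ∀ u v, q u v = q v u) (hf : ∀ z, f z = 0 → 0 ≤ q z z) {v w : E}
    (hv : 0 < f v) (hw : 0 < f w) (hqv : q v v ≤ 0) (hqw : q w w ≤ 0) :
    √(-q v v) * √(-q w w) ≤ -q v w := by
  -- this combination of `v` and `w` lies in the kernel of `f`
  have hz := hf (f w • v - f v • w) (by simp; ring)
  have hzz : q (f w • v - f v • w) (f w • v - f v • w) =
      f w ^ 2 * q v v - 2 * (f w * f v) * q v w + f v ^ 2 * q w w := by
    simp [hq w v]; ring
  have ha := Real.sq_sqrt (neg_nonneg.2 hqv)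
  have hb := Real.sq_sqrt (neg_nonneg.2 hqw)
  have hp : 0 < f w * f v := mul_pos hw hv
  refine le_of_mul_le_mul_left ?_ hp
  rw [hzz] at hz
  nlinarith [sq_nonneg (f w * √(-q v v) - f v * √(-q w w))]

/-- The causal vectors of `q` whose norm is controlled by the time form `f`, with constant `K`.
The condition on the norm makes `f` nonnegative, which singles out the future directed vectors; the
cone is closed, and it is convex if `q` is nonnegative on the kernel of `f`. -/
def causalCone (q : E →L[ℝ] E →L[ℝ] ℝ) (f : E →L[ℝ] ℝ) (K : ℝ) : Set E :=
  {v | ‖v‖ ≤ K * f v ∧ q v v ≤ 0}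

variable {q : E →L[ℝ] E →L[ℝ] ℝ} {f : E →L[ℝ] ℝ} {K : ℝ}

lemma isClosed_causalCone : IsClosed (causalCone q f K) := by
  have h1 : IsClosed {v : E | ‖v‖ ≤ K * f v} := isClosed_le (by fun_prop) (by fun_prop)
  have h2 : IsClosed {v : E | q v v ≤ 0} := isClosed_le (by fun_prop) (by fun_prop)
  exact h1.inter h2

lemma pos_of_mem_causalCone (hK : 0 < K) {v : E} (hv : v ∈ causalCone q f K) (h0 : v ≠ 0) :
    0 < f v :=
  pos_of_mul_pos_right ((norm_pos_iff.2 h0).trans_le hv.1) hK.le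

lemma nonneg_of_mem_causalCone (hK : 0 < K) {v : E} (hv : v ∈ causalCone q f K) : 0 ≤ f v :=
  nonneg_of_mul_nonneg_right ((norm_nonneg v).trans hv.1) hK

lemma smul_mem_causalCone {v : E} (hv : v ∈ causalCone q f K) {c : ℝ} (hc : 0 ≤ c) :
    c • v ∈ causalCone q f K := by
  refine ⟨?_, ?_⟩
  · rw [norm_smul, Real.norm_of_nonneg hc, map_smul, smul_eq_mul]
    nlinarith [mul_le_mul_of_nonneg_left hv.1 hc]
  · simp only [map_smul, smul_apply, smul_eq_mul]
    nlinarith [mul_nonneg hc hc, hv.2]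

lemma sqrt_mul_sqrt_le_neg_of_mem_causalCone (hK : 0 < K) (hq : ∀ u v, q u v = q v u)
    (hf : ∀ z, f z = 0 → 0 ≤ q z z) {v w : E} (hv : v ∈ causalCone q f K)
    (hw : w ∈ causalCone q f K) : √(-q v v) * √(-q w w) ≤ -q v w := by
  rcases eq_or_ne v 0 with rfl | hv0
  · simp
  rcases eq_or_ne w 0 with rfl | hw0
  · simp
  exact sqrt_mul_sqrt_le_neg hq hf (pos_of_mem_causalCone hK hv hv0)
    (pos_of_mem_causalCone hK hw hw0) hv.2 hw.2

lemma add_mem_causalCone (hK : 0 < K) (hq : ∀ u v, q u v = q v u)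
    (hf : ∀ z, f z = 0 → 0 ≤ q z z) {v w : E} (hv : v ∈ causalCone q f K)
    (hw : w ∈ causalCone q f K) : v + w ∈ causalCone q f K := by
  refine ⟨?_, ?_⟩
  · rw [map_add, mul_add]
    exact (norm_add_le v w).trans (add_le_add hv.1 hw.1)
  · have h := sqrt_mul_sqrt_le_neg_of_mem_causalCone hK hq hf hv hw
    have h' : 0 ≤ √(-q v v) * √(-q w w) := by positivity
    simp only [map_add, add_apply, hq w v]
    linarith [hv.2, hw.2]

/-- The reversed triangle inequality. -/
lemma sqrt_add_sqrt_le (hK : 0 < K) (hq : ∀ u v, q u v = q v u)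
    (hf : ∀ z, f z = 0 → 0 ≤ q z z) {v w : E} (hv : v ∈ causalCone q f K)
    (hw : w ∈ causalCone q f K) :
    √(-q v v) + √(-q w w) ≤ √(-q (v + w) (v + w)) := by
  have h := sqrt_mul_sqrt_le_neg_of_mem_causalCone hK hq hf hv hw
  have ha := Real.sq_sqrt (neg_nonneg.2 hv.2)
  have hb := Real.sq_sqrt (neg_nonneg.2 hw.2)
  refine Real.le_sqrt_of_sq_le ?_
  simp only [map_add, add_apply, hq w v]
  nlinarith

lemma concaveOn_sqrt_neg (hK : 0 < K) (hq : ∀ u v, q u v = q v u)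
    (hf : ∀ z, f z = 0 → 0 ≤ q z z) :
    ConcaveOn ℝ (causalCone q f K) fun v ↦ √(-q v v) := by
  have hsmul : ∀ (v : E) (c : ℝ), 0 ≤ c → √(-q (c • v) (c • v)) = c * √(-q v v) := by
    intro v c hc
    simp only [map_smul, smul_apply, smul_eq_mul]
    rw [show -(c * (c * q v v)) = c ^ 2 * (-q v v) by ring, Real.sqrt_mul (sq_nonneg c),
      Real.sqrt_sq hc]
  refine ⟨fun v hv w hw a b ha hb _ ↦ add_mem_causalCone hK hq hf (smul_mem_causalCone hv ha)
    (smul_mem_causalCone hw hb), fun v hv w hw a b ha hb _ ↦ ?_⟩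
  have := sqrt_add_sqrt_le hK hq hf (smul_mem_causalCone hv ha) (smul_mem_causalCone hw hb)
  simpa only [hsmul _ _ ha, hsmul _ _ hb, smul_eq_mul] using this

/-- A curve with velocities in the causal cone has its displacement in that cone, and the
straight line is the longest such curve. -/
lemma sub_mem_causalCone_and_lintegral_le [FiniteDimensional ℝ E] (hK : 0 < K)
    (hq : ∀ u v, q u v = q v u) (hf : ∀ z, f z = 0 → 0 ≤ q z z) {c : ℝ → E}
    (hc : ContDiffOn ℝ 1 c (Icc 0 1))
    (hmem : ∀ s ∈ Icc (0 : ℝ) 1, derivWithin c (Icc 0 1) s ∈ causalCone q f K) :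
    c 1 - c 0 ∈ causalCone q f K ∧
      ∫⁻ s in Icc (0 : ℝ) 1, ENNReal.ofReal
        √(-q (derivWithin c (Icc 0 1) s) (derivWithin c (Icc 0 1) s)) ≤
      ENNReal.ofReal √(-q (c 1 - c 0) (c 1 - c 0)) := by
  set μ := (volume : Measure ℝ).restrict (Icc 0 1) with hμ
  have : IsProbabilityMeasure μ := ⟨by simp [hμ]⟩
  have hcont : ContinuousOn (derivWithin c (Icc 0 1)) (Icc 0 1) :=
    hc.continuousOn_derivWithin uniqueDiffOn_Icc_zero_one le_rfl
  have hint : Integrable (derivWithin c (Icc 0 1)) μ := hcont.integrableOn_Icc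
  have hNc : Continuous fun v : E ↦ √(-q v v) := by fun_prop
  have hint' : Integrable ((fun v : E ↦ √(-q v v)) ∘ derivWithin c (Icc 0 1)) μ :=
    (hNc.comp_continuousOn hcont).integrableOn_Icc
  have hae : ∀ᵐ s ∂μ, derivWithin c (Icc 0 1) s ∈ causalCone q f K :=
    (ae_restrict_iff' measurableSet_Icc).2 (ae_of_all _ hmem)
  have hI : ∫ s, derivWithin c (Icc 0 1) s ∂μ = c 1 - c 0 := by
    rw [← intervalIntegral.integral_derivWithin_Icc_of_contDiffOn_Icc hc zero_le_one,
      intervalIntegral.integral_of_le zero_le_one, hμ, integral_Icc_eq_integral_Ioc]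
  have hconc := concaveOn_sqrt_neg hK hq hf
  refine ⟨hI ▸ hconc.1.integral_mem isClosed_causalCone hae hint, ?_⟩
  have hl := ofReal_integral_eq_lintegral_ofReal hint' (ae_of_all _ fun s ↦ Real.sqrt_nonneg _)
  simp only [Function.comp_apply] at hl
  rw [← hI, ← hl]
  exact ENNReal.ofReal_le_ofReal
    (hconc.le_map_integral hNc.continuousOn isClosed_causalCone hae hint hint')

end LorentzianForm

/-! ### Local comparison of the separation with straight lines -/

section Local

variable {E : Type*} [NormedAddCommGroup E] [NormedSpace ℝ E]
  {M : Type*} [TopologicalSpace M] [ChartedSpace E M] [IsManifold 𝓘(ℝ, E) ∞ M]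
  {g : LorentzianMetric E M}

lemma TimeOrientation.Trip.mono {τ : g.TimeOrientation} {U V : Set M} (h : U ⊆ V) {x y : M}
    {l : ℝ≥0∞} (ht : τ.Trip U x y l) : τ.Trip V x y l := by
  induction ht with
  | refl x hx => exact .refl x (h hx)
  | cons σ z l hσ _ ih => exact .cons σ z l ⟨hσ.1, fun s hs ↦ h (hσ.2.1 hs), hσ.2.2⟩ ih

lemma TimeOrientation.Trip.trans {τ : g.TimeOrientation} {U : Set M} {x y z : M}
    {l l' : ℝ≥0∞} (h : τ.Trip U x y l) (h' : τ.Trip U y z l') : τ.Trip U x z (l + l') := by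
  induction h with
  | refl x hx => simpa using h'
  | cons σ w l hσ _ ih => rw [add_assoc]; exact .cons σ z _ hσ (ih h')

lemma TimeOrientation.Trip.mem {τ : g.TimeOrientation} {U : Set M} {x y : M}
    {l : ℝ≥0∞} (h : τ.Trip U x y l) : x ∈ U ∧ y ∈ U := by
  induction h with
  | refl x hx => exact ⟨hx, hx⟩
  | cons σ w l hσ _ ih => exact ⟨hσ.2.1 (by simp), ih.2⟩

lemma abs_apply_sub_apply_le {β β' : E →L[ℝ] E →L[ℝ] ℝ} {e : ℝ} (h : ‖β - β'‖ ≤ e)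
    (u v : E) : |β u v - β' u v| ≤ e * (‖u‖ * ‖v‖) := by
  have h1 : |(β - β') u v| ≤ ‖β - β'‖ * ‖u‖ * ‖v‖ := (β - β').le_opNorm₂ u v
  have h2 : ‖β - β'‖ * ‖u‖ * ‖v‖ ≤ e * (‖u‖ * ‖v‖) := by rw [mul_assoc]; gcongr
  exact h1.trans h2

lemma eventually_norm_sub_le_of_continuousAt {X F : Type*} [TopologicalSpace X]
    [SeminormedAddCommGroup F] {u : X → F} {x : X} (h : ContinuousAt u x) {e : ℝ} (he : 0 < e) :
    ∀ᶠ y in 𝓝 x, ‖u y - u x‖ ≤ e := by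
  simpa [dist_eq_norm] using h.eventually (Metric.closedBall_mem_nhds _ he)

set_option synthInstance.maxHeartbeats 200000 in
lemma eventually_norm_chartMetric_sub_le [FiniteDimensional ℝ E] (g : LorentzianMetric E M)
    {x₀ z : M} (hz : z ∈ (chartAt E x₀).source) {e : ℝ} (he : 0 < e) :
    ∀ᶠ x in 𝓝 z, ‖g.chartMetric x₀ x - g.chartMetric x₀ z‖ ≤ e :=
  have h : ContinuousAt (g.chartMetric x₀) z :=
    (continuousOn_chartMetric g x₀).continuousAt ((chartAt E x₀).open_source.mem_nhds hz)
  eventually_norm_sub_le_of_continuousAt (F := E →L[ℝ] E →L[ℝ] ℝ) h he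

lemma chartMetric_signature (g : LorentzianMetric E M) {x₀ x : M}
    (hx : x ∈ (chartAt E x₀).source) :
    ∃ v, g.chartMetric x₀ x v v < 0 ∧
      ∀ w, g.chartMetric x₀ x v w = 0 → w ≠ 0 → 0 < g.chartMetric x₀ x w w := by
  obtain ⟨v, hv, hvw⟩ := g.signature x
  refine ⟨chartVector E x₀ x v, by rwa [chartMetric_chartVector g hx], fun w hw hw0 ↦ ?_⟩
  obtain ⟨w', rfl⟩ := exists_chartVector_eq hx w
  rw [chartMetric_chartVector g hx] at hw ⊢
  exact hvw w' hw fun h ↦ hw0 ((chartVector_eq_zero_iff hx w').2 h)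

/-- The form dual to the time orientation at `x`, in the chart centred at `x₀`. It is nonpositive
on the future directed causal vectors. -/
noncomputable def TimeOrientation.chartForm (τ : g.TimeOrientation) (x₀ x : M) : E →L[ℝ] ℝ :=
  g.chartMetric x₀ x (chartVector E x₀ x (τ.field x))

lemma TimeOrientation.continuousOn_chartForm [FiniteDimensional ℝ E] (τ : g.TimeOrientation)
    (x₀ : M) : ContinuousOn (τ.chartForm x₀) (chartAt E x₀).source :=
  (continuousOn_chartMetric g x₀).clm_apply (τ.continuousOn_chartField x₀)

lemma TimeOrientation.eventually_norm_chartForm_sub_le [FiniteDimensional ℝ E]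
    (τ : g.TimeOrientation) {x₀ z : M} (hz : z ∈ (chartAt E x₀).source) {e : ℝ} (he : 0 < e) :
    ∀ᶠ x in 𝓝 z, ‖τ.chartForm x₀ x - τ.chartForm x₀ z‖ ≤ e :=
  eventually_norm_sub_le_of_continuousAt
    ((τ.continuousOn_chartForm x₀).continuousAt ((chartAt E x₀).open_source.mem_nhds hz)) he

lemma TimeOrientation.isFutureCausal_iff (τ : g.TimeOrientation) {x₀ x : M}
    (hx : x ∈ (chartAt E x₀).source) (v : TangentSpace 𝓘(ℝ, E) x) :
    τ.IsFutureCausal x v ↔ chartVector E x₀ x v ≠ 0 ∧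
      g.chartMetric x₀ x (chartVector E x₀ x v) (chartVector E x₀ x v) ≤ 0 ∧
      τ.chartForm x₀ x (chartVector E x₀ x v) ≤ 0 := by
  rw [TimeOrientation.chartForm, chartMetric_chartVector g hx, chartMetric_chartVector g hx, Ne,
    chartVector_eq_zero_iff hx]
  rfl

/-- `f` is, on `R`, uniformly a time function in the chart centred at `x₀`: it controls the norm
of each causal vector, and it is nonnegative on the future directed ones. -/
structure TimeOrientation.IsTimeForm (τ : g.TimeOrientation) (x₀ : M) (R : Set M)
    (f : E →L[ℝ] ℝ) (K : ℝ) : Prop where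
  pos : 0 < K
  subset : R ⊆ (chartAt E x₀).source
  norm_le : ∀ x ∈ R, ∀ v, g.chartMetric x₀ x v v ≤ 0 → ‖v‖ ≤ K * |f v|
  nonneg : ∀ x ∈ R, ∀ v, g.chartMetric x₀ x v v ≤ 0 → τ.chartForm x₀ x v ≤ 0 → 0 ≤ f v

lemma TimeOrientation.IsTimeForm.mono {τ : g.TimeOrientation} {x₀ : M} {R B : Set M}
    {f : E →L[ℝ] ℝ} {K : ℝ} (h : τ.IsTimeForm x₀ R f K) (hB : B ⊆ R) :
    τ.IsTimeForm x₀ B f K :=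
  ⟨h.pos, hB.trans h.subset, fun x hx ↦ h.norm_le x (hB hx), fun x hx ↦ h.nonneg x (hB hx)⟩

/-- Near `x₀` the negative of the form dual to the time orientation at `x₀` is a time form. -/
lemma TimeOrientation.exists_isTimeForm [FiniteDimensional ℝ E] (τ : g.TimeOrientation) (x₀ : M) :
    ∃ R, IsOpen R ∧ x₀ ∈ R ∧ ∃ f K, τ.IsTimeForm x₀ R f K ∧
      ∃ e > 0, ∀ x ∈ R, ‖g.chartMetric x₀ x - g.chartMetric x₀ x₀‖ ≤ e := by
  have hx₀ : x₀ ∈ (chartAt E x₀).source := mem_chart_source E x₀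
  have hT : g.chartMetric x₀ x₀ (chartVector E x₀ x₀ (τ.field x₀))
      (chartVector E x₀ x₀ (τ.field x₀)) < 0 := by
    rw [chartMetric_chartVector g hx₀]; exact τ.timelike x₀
  obtain ⟨c, hc, r, hr, hcr⟩ := exists_pos_mul_norm_sq_le (chartMetric_symm g x₀ x₀)
    (chartMetric_signature g hx₀) hT
  set F := τ.chartForm x₀ x₀ with hF
  change ∀ v, _ ≤ _ + r * (F v) ^ 2 at hcr
  -- if the metric is within `c / 2` of the one at `x₀`, its causal vectors `v` satisfy
  -- `c / 2 * ‖v‖ ^ 2 ≤ r * (F v) ^ 2`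
  set K := √(2 * r / c) with hK
  have hK0 : 0 < K := by positivity
  have hKsq : K ^ 2 = 2 * r / c := Real.sq_sqrt (by positivity)
  have hev : ∀ᶠ x in 𝓝 x₀, x ∈ (chartAt E x₀).source ∧
      ‖g.chartMetric x₀ x - g.chartMetric x₀ x₀‖ ≤ c / 2 ∧
      ‖τ.chartForm x₀ x - F‖ ≤ 1 / (2 * K) :=
    ((chartAt E x₀).open_source.eventually_mem hx₀).and
      ((eventually_norm_chartMetric_sub_le g hx₀ (half_pos hc)).and
      (τ.eventually_norm_chartForm_sub_le hx₀ (by positivity)))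
  obtain ⟨R, hR, hRo, hxR⟩ := eventually_nhds_iff.1 hev
  have hnorm : ∀ x ∈ R, ∀ v, g.chartMetric x₀ x v v ≤ 0 → ‖v‖ ≤ K * |-F v| := by
    intro x hx v hv
    have ha := (abs_le.1 (abs_apply_sub_apply_le (hR x hx).2.1 v v)).1
    have hb := hcr v
    rw [abs_neg]
    refine le_of_sq_le_sq ?_ (by positivity)
    rw [mul_pow, hKsq, sq_abs, div_mul_eq_mul_div, le_div_iff₀ hc]
    nlinarith
  refine ⟨R, hRo, hxR, -F, K, ⟨hK0, fun x hx ↦ (hR x hx).1, hnorm, ?_⟩, c / 2, half_pos hc,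
    fun x hx ↦ (hR x hx).2.1⟩
  intro x hx v hv hfut
  have ha := hnorm x hx v hv
  have hb : F v - τ.chartForm x₀ x v ≤ 1 / (2 * K) * ‖v‖ := by
    have h3 : ‖(τ.chartForm x₀ x - F) v‖ ≤ 1 / (2 * K) * ‖v‖ :=
      ((τ.chartForm x₀ x - F).le_opNorm v).trans (by gcongr; exact (hR x hx).2.2)
    rw [sub_apply, norm_sub_rev] at h3
    exact (le_abs_self _).trans h3
  have hd : 1 / (2 * K) * ‖v‖ ≤ 1 / 2 * |-F v| := by
    calc _ ≤ 1 / (2 * K) * (K * |-F v|) := by gcongr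
      _ = _ := by field_simp
  change 0 ≤ -F v
  by_contra! hneg
  rw [abs_of_neg hneg] at hd
  linarith

/-- The metric at `z`, with its causal cone widened along the time form `f` so that it contains
the causal cones of the metrics at distance at most `e`. -/
noncomputable def wideMetric (g : LorentzianMetric E M) (x₀ z : M) (f : E →L[ℝ] ℝ) (e K : ℝ) :
    E →L[ℝ] E →L[ℝ] ℝ :=
  g.chartMetric x₀ z - (e * K ^ 2) • f.smulRight f

lemma wideMetric_apply (g : LorentzianMetric E M) (x₀ z : M) (f : E →L[ℝ] ℝ) (e K : ℝ) (u v : E) :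
    g.wideMetric x₀ z f e K u v = g.chartMetric x₀ z u v - e * K ^ 2 * (f u * f v) := by
  simp [wideMetric]

section

variable {τ : g.TimeOrientation} {x₀ : M} {B : Set M} {f : E →L[ℝ] ℝ} {K : ℝ}

lemma TimeOrientation.IsTimeForm.wideMetric_nonneg (hf : τ.IsTimeForm x₀ B f K) {z : M}
    (hz : z ∈ B) (e : ℝ) {v : E} (hv : f v = 0) : 0 ≤ g.wideMetric x₀ z f e K v v := by
  rw [wideMetric_apply, hv]
  by_contra! h
  have h1 : g.chartMetric x₀ z v v ≤ 0 := by linarith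
  have h2 := hf.norm_le z hz v h1
  have h3 : v = 0 := by simpa [hv] using h2
  simp [h3] at h

lemma wideMetric_symm (g : LorentzianMetric E M) (x₀ z : M) (f : E →L[ℝ] ℝ) (e K : ℝ) (u v : E) :
    g.wideMetric x₀ z f e K u v = g.wideMetric x₀ z f e K v u := by
  rw [wideMetric_apply, wideMetric_apply, chartMetric_symm]; ring

lemma wideMetric_le {x z : M} {e : ℝ} (he : 0 ≤ e)
    (hxz : ‖g.chartMetric x₀ x - g.chartMetric x₀ z‖ ≤ e) {v : E} (hv : ‖v‖ ≤ K * f v) :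
    g.wideMetric x₀ z f e K v v ≤ g.chartMetric x₀ x v v := by
  have ha := (abs_le.1 (abs_apply_sub_apply_le hxz v v)).1
  have hb : ‖v‖ ^ 2 ≤ (K * f v) ^ 2 := by gcongr
  rw [wideMetric_apply]
  nlinarith

/-- In a region where the metric is `e`-close to its value at `z`, causal trips are no longer
than the straight line is for the widened metric at `z`. -/
lemma TimeOrientation.Trip.sub_mem_causalCone_and_le [FiniteDimensional ℝ E]
    (hf : τ.IsTimeForm x₀ B f K) {z : M} (hz : z ∈ B) {e : ℝ} (he : 0 ≤ e)
    (hB : ∀ x ∈ B, ‖g.chartMetric x₀ x - g.chartMetric x₀ z‖ ≤ e) {x y : M} {l : ℝ≥0∞}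
    (h : τ.Trip B x y l) :
    chartAt E x₀ y - chartAt E x₀ x ∈ causalCone (g.wideMetric x₀ z f e K) f K ∧
      l ≤ ENNReal.ofReal √(-g.wideMetric x₀ z f e K (chartAt E x₀ y - chartAt E x₀ x)
        (chartAt E x₀ y - chartAt E x₀ x)) := by
  have hq := wideMetric_symm g x₀ z f e K
  have hqf := fun v ↦ hf.wideMetric_nonneg hz e (v := v)
  set q := g.wideMetric x₀ z f e K with hqdef
  induction h with
  | refl x hx => simp [causalCone]
  | cons σ y l hσ _ ih =>
    have hs : MapsTo σ (Icc 0 1) (chartAt E x₀).source := fun s hs ↦ hf.subset (hσ.2.1 hs)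
    set c := chartAt E x₀ ∘ σ with hc
    have hd : ∀ s ∈ Icc (0 : ℝ) 1, derivWithin c (Icc 0 1) s ∈ causalCone q f K ∧
        q (derivWithin c (Icc 0 1) s) (derivWithin c (Icc 0 1) s) ≤
          g.inner (σ s) (velocity E σ s) (velocity E σ s) := by
      intro s hs'
      have h1 := (τ.isFutureCausal_iff (hs hs') _).1 (hσ.2.2 s hs')
      have h2 := chartMetric_chartVector g (hs hs') (velocity E σ s) (velocity E σ s)
      rw [derivWithin_chart_comp hσ.1 hs hs', ← hc] at h1 h2
      have h3 := hf.norm_le _ (hσ.2.1 hs') _ h1.2.1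
      rw [abs_of_nonneg (hf.nonneg _ (hσ.2.1 hs') _ h1.2.1 h1.2.2)] at h3
      have h4 := wideMetric_le he (hB _ (hσ.2.1 hs')) h3
      exact ⟨⟨h3, h4.trans h1.2.1⟩, h2 ▸ h4⟩
    obtain ⟨h1, h2⟩ := sub_mem_causalCone_and_lintegral_le hf.pos hq hqf
      ((contDiffOn_chart_comp hσ.1 hs).of_le (by simp)) fun s hs ↦ (hd s hs).1
    have h3 : g.arcLength σ ≤ ENNReal.ofReal √(-q (c 1 - c 0) (c 1 - c 0)) := by
      refine le_trans ?_ h2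
      refine setLIntegral_mono' measurableSet_Icc fun s hs' ↦ ?_
      gcongr
      exact (hd s hs').2
    have hsum : chartAt E x₀ y - chartAt E x₀ (σ 0) =
      (c 1 - c 0) + (chartAt E x₀ y - chartAt E x₀ (σ 1)) := by simp [hc]
    rw [hsum]
    refine ⟨add_mem_causalCone hf.pos hq hqf h1 ih.1, (add_le_add h3 ih.2).trans ?_⟩
    rw [← ENNReal.ofReal_add (Real.sqrt_nonneg _) (Real.sqrt_nonneg _)]
    exact ENNReal.ofReal_le_ofReal (sqrt_add_sqrt_le hf.pos hq hqf h1 ih.1)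

/-- The straight line in a chart, as a causal trip. -/
lemma TimeOrientation.exists_trip_line (τ : g.TimeOrientation) {x₀ x y : M} {r : ℝ}
    (hx : x ∈ (chartAt E x₀).source) (hy : y ∈ (chartAt E x₀).source)
    {A : Set E} (hA : Convex ℝ A) (hAt : A ⊆ (chartAt E x₀).target)
    (hAB : ∀ u ∈ A, (chartAt E x₀).symm u ∈ B)
    (hxA : chartAt E x₀ x ∈ A) (hyA : chartAt E x₀ y ∈ A) {D : E}
    (hD : D = chartAt E x₀ y - chartAt E x₀ x) (hD0 : D ≠ 0)
    (hcaus : ∀ w ∈ B, g.chartMetric x₀ w D D ≤ -r ∧ τ.chartForm x₀ w D ≤ 0) (hr : 0 ≤ r) :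
    ∃ l, τ.Trip B x y l ∧ ENNReal.ofReal √r ≤ l := by
  set φ := chartAt E x₀ with hφ
  set c : ℝ → E := fun s ↦ φ x + s • D with hc
  set σ : ℝ → M := fun s ↦ φ.symm (c s) with hσ
  have hcA : MapsTo c (Icc 0 1) A := by
    intro s hs
    have := hA.add_smul_sub_mem hxA hyA hs
    simpa [hc, hD] using this
  have hσ0 : σ 0 = x := by simp [hσ, hc, hx]
  have hσ1 : σ 1 = y := by simp [hσ, hc, hD, hy]
  have hcs : ContMDiff 𝓘(ℝ, ℝ) 𝓘(ℝ, E) ∞ c := by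
    rw [contMDiff_iff_contDiff]; fun_prop
  have hsm : ContMDiffOn 𝓘(ℝ, ℝ) 𝓘(ℝ, E) ∞ σ (Icc 0 1) :=
    (contMDiffOn_chart_symm (I := 𝓘(ℝ, E)) (n := ∞) (x := x₀)).comp hcs.contMDiffOn
      fun s hs ↦ hAt (hcA hs)
  have hsB : MapsTo σ (Icc 0 1) B := fun s hs ↦ hAB _ (hcA hs)
  have hsS : MapsTo σ (Icc 0 1) φ.source := fun s hs ↦ φ.map_target (hAt (hcA hs))
  have hvel : ∀ s ∈ Icc (0 : ℝ) 1, chartVector E x₀ (σ s) (velocity E σ s) = D := by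
    intro s hs
    rw [derivWithin_chart_comp hsm hsS hs]
    have h1 : HasDerivWithinAt c D (Icc 0 1) s := by
      simpa [hc] using (((hasDerivAt_id s).smul_const D).const_add (φ x)).hasDerivWithinAt
    refine (h1.congr (fun t ht ↦ ?_) ?_).derivWithin (uniqueDiffOn_Icc_zero_one s hs)
    · exact φ.right_inv (hAt (hcA ht))
    · exact φ.right_inv (hAt (hcA hs))
  have harc : τ.IsFutureArc B σ := by
    refine ⟨hsm, hsB, fun s hs ↦ ?_⟩
    rw [τ.isFutureCausal_iff (hsS hs), hvel s hs]
    have := hcaus _ (hsB hs)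
    exact ⟨hD0, this.1.trans (neg_nonpos.2 hr), this.2⟩
  refine ⟨g.arcLength σ + 0, ?_, ?_⟩
  · have := TimeOrientation.Trip.cons (τ := τ) σ (σ 1) 0 harc (.refl _ (hsB (by simp)))
    rwa [hσ0, hσ1] at this
  · rw [add_zero]
    calc ENNReal.ofReal √r = ∫⁻ s in Icc (0 : ℝ) 1, ENNReal.ofReal √r := by simp
      _ ≤ g.arcLength σ := setLIntegral_mono' measurableSet_Icc fun s hs ↦ by
        gcongr
        have h2 := chartMetric_chartVector g (hsS hs) (velocity E σ s) (velocity E σ s)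
        rw [hvel s hs] at h2
        linarith [(hcaus _ (hsB hs)).1]

end

/-- Every point has a neighbourhood `R` with a time function `h` such that, in small
neighbourhoods `B` of any point of `R`, the separation is bounded by a continuous function `n`,
and it attains that bound between causally related points up to `ε` times the increment
of `h`. -/
lemma TimeOrientation.exists_local_comparison [FiniteDimensional ℝ E] (τ : g.TimeOrientation)
    (x₀ : M) :
    ∃ R, IsOpen R ∧ x₀ ∈ R ∧ ∃ h : M → ℝ, (∀ x y l, τ.Trip R x y l → h x ≤ h y) ∧
      ∀ z ∈ R, ∀ ε > 0, ∀ V ∈ 𝓝 z, ∃ B, IsOpen B ∧ z ∈ B ∧ B ⊆ V ∧ B ⊆ R ∧ ∃ n : M → M → ℝ,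
        ContinuousOn (Function.uncurry n) (B ×ˢ B) ∧
        (∀ x y, n x y = n y x) ∧
        (∀ x y, τ.separation B x y ≤ ENNReal.ofReal (n x y)) ∧
        ∀ x y l, τ.Trip B x y l → ∃ l', τ.Trip B x y l' ∧
          ENNReal.ofReal (n x y) ≤ l' + ENNReal.ofReal (ε * (h y - h x)) := by
  obtain ⟨R, hRo, hxR, f, K, hf, e₀, he₀, hRe⟩ := τ.exists_isTimeForm x₀
  set φ := chartAt E x₀ with hφ
  have hK := hf.pos
  refine ⟨R, hRo, hxR, fun x ↦ f (φ x), fun x y l hl ↦ ?_, fun z hz ε hε V hV ↦ ?_⟩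
  · have h1 := (hl.sub_mem_causalCone_and_le hf hxR he₀.le hRe).1
    have h2 := nonneg_of_mem_causalCone hK h1
    rw [map_sub] at h2
    linarith
  -- with this closeness, the two error terms add up to `ε` times the time form
  set e := ε ^ 2 / (2 * K ^ 2) with he
  have he0 : 0 < e := by positivity
  have hzS : z ∈ φ.source := hf.subset hz
  have hW : {x | x ∈ V ∧ x ∈ R ∧ ‖g.chartMetric x₀ x - g.chartMetric x₀ z‖ ≤ e} ∈ 𝓝 z := by
    filter_upwards [hV, hRo.mem_nhds hz, eventually_norm_chartMetric_sub_le g hzS he0]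
      with x h1 h2 h3
    exact ⟨h1, h2, h3⟩
  set W := {x | x ∈ V ∧ x ∈ R ∧ ‖g.chartMetric x₀ x - g.chartMetric x₀ z‖ ≤ e} with hWdef
  have hnhds : φ.target ∩ φ.symm ⁻¹' W ∈ 𝓝 (φ z) := by
    refine inter_mem (φ.open_target.mem_nhds (φ.map_source hzS)) ?_
    refine (φ.continuousAt_symm (φ.map_source hzS)).preimage_mem_nhds ?_
    rwa [φ.left_inv hzS]
  obtain ⟨r, hr, hball⟩ := Metric.mem_nhds_iff.1 hnhds
  set A := Metric.ball (φ z) r with hA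
  set B := φ.source ∩ φ ⁻¹' A with hBdef
  have hBW : B ⊆ W := fun x hx ↦ by
    have := (hball hx.2).2
    rwa [mem_preimage, φ.left_inv hx.1] at this
  have hzB : z ∈ B := ⟨hzS, Metric.mem_ball_self hr⟩
  have hfB : τ.IsTimeForm x₀ B f K := hf.mono fun x hx ↦ (hBW hx).2.1
  have hBe : ∀ x ∈ B, ‖g.chartMetric x₀ x - g.chartMetric x₀ z‖ ≤ e := fun x hx ↦ (hBW hx).2.2
  set q := g.wideMetric x₀ z f e K with hq
  have hsymm : ∀ x y : M,
      √(-q (φ y - φ x) (φ y - φ x)) = √(-q (φ x - φ y) (φ x - φ y)) := by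
    intro x y
    rw [← neg_sub (φ x) (φ y)]
    simp only [map_neg, neg_apply, neg_neg]
  refine ⟨B, φ.isOpen_inter_preimage Metric.isOpen_ball, hzB, fun x hx ↦ (hBW hx).1,
    fun x hx ↦ (hBW hx).2.1, fun x y ↦ √(-q (φ y - φ x) (φ y - φ x)), ?_, hsymm, ?_, ?_⟩
  · have h1 : ContinuousOn φ B := φ.continuousOn.mono inter_subset_left
    have h2 : ContinuousOn (fun p : M × M ↦ φ p.2 - φ p.1) (B ×ˢ B) :=
      (h1.comp continuousOn_snd fun p hp ↦ hp.2).sub (h1.comp continuousOn_fst fun p hp ↦ hp.1)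
    have h3 : Continuous fun v : E ↦ √(-q v v) := by fun_prop
    exact h3.comp_continuousOn h2
  · intro x y
    refine iSup₂_le fun l hl ↦ ?_
    rcases hl with hl | hl
    · exact (hl.sub_mem_causalCone_and_le hfB hzB he0.le hBe).2
    · change l ≤ ENNReal.ofReal √(-q (φ y - φ x) (φ y - φ x))
      rw [hsymm]
      exact (hl.sub_mem_causalCone_and_le hfB hzB he0.le hBe).2
  · intro x y l hl
    have hD := (hl.sub_mem_causalCone_and_le hfB hzB he0.le hBe).1
    obtain ⟨hxB, hyB⟩ := hl.mem
    rw [← map_sub]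
    set D := φ y - φ x with hDdef
    have hfD := nonneg_of_mem_causalCone hK hD
    set m := -g.chartMetric x₀ z D D - e * ‖D‖ ^ 2 with hm
    have hest : √(-q D D) ≤ √m + ε * f D := by
      have h1 : -q D D ≤ m + (ε * f D) ^ 2 := by
        have h2 : ‖D‖ ^ 2 ≤ (K * f D) ^ 2 := by gcongr; exact hD.1
        have h3 : (ε * f D) ^ 2 = 2 * e * (K * f D) ^ 2 := by rw [he]; field_simp
        rw [h3, hq, wideMetric_apply, hm]
        nlinarith
      refine (Real.sqrt_le_sqrt h1).trans ?_
      rw [Real.sqrt_le_left (by positivity)]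
      have hεf : 0 ≤ ε * f D := by positivity
      -- if `m` is negative, then `√m = 0`
      rcases le_total 0 m with h0 | h0
      · nlinarith [Real.sq_sqrt h0, Real.sqrt_nonneg m]
      · rw [Real.sqrt_eq_zero_of_nonpos h0]; nlinarith
    have hest' := (ENNReal.ofReal_le_ofReal hest).trans ENNReal.ofReal_add_le
    rcases le_or_gt m 0 with hm0 | hm0
    · rw [Real.sqrt_eq_zero_of_nonpos hm0, ENNReal.ofReal_zero, zero_add] at hest'
      exact ⟨l, hl, hest'.trans le_add_self⟩
    have hD0 : D ≠ 0 := by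
      rintro h0
      simp [hm, h0] at hm0
    have hcaus : ∀ w ∈ B, g.chartMetric x₀ w D D ≤ -m ∧ τ.chartForm x₀ w D ≤ 0 := by
      intro w hw
      have h1 : g.chartMetric x₀ w D D ≤ -m := by
        have := (abs_le.1 (abs_apply_sub_apply_le (hBe w hw) D D)).2
        rw [hm]; linarith
      refine ⟨h1, ?_⟩
      -- otherwise `-D` would be future directed
      by_contra! hpast
      have h2 := hfB.nonneg w hw (-D) (by simpa using h1.trans (by linarith))
        (by simpa using hpast.le)
      rw [map_neg] at h2
      linarith [pos_of_mem_causalCone hK hD hD0]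
    obtain ⟨l', hl', hml⟩ := τ.exists_trip_line (B := B) (r := m) hxB.1 hyB.1
      (convex_ball (φ z) r) (fun u hu ↦ (hball hu).1)
      (fun u hu ↦ ⟨φ.map_target (hball hu).1, by
        rw [mem_preimage, φ.right_inv (hball hu).1]; exact hu⟩) hxB.2 hyB.2 hDdef hD0 hcaus hm0.le
    exact ⟨l', hl', hest'.trans (add_le_add hml le_rfl)⟩

end Local

open scoped NNReal

/-! ### Partitions and the monotonicity of the length -/

section Partition

variable {E : Type*} [NormedAddCommGroup E] [NormedSpace ℝ E]
  {M : Type*} [TopologicalSpace M] [ChartedSpace E M] [IsManifold 𝓘(ℝ, E) ∞ M]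
  {g : LorentzianMetric E M}

lemma TimeOrientation.lengthIcc_le_sum (τ : g.TimeOrientation) {γ : ℝ → M} {s t : ℝ} {n : ℕ}
    {p : ℕ → ℝ} {U : ℕ → Set M} (h : Monotone p ∧ p 0 = s ∧ p n = t ∧
      ∀ j < n, IsOpen (U j) ∧ γ '' Icc (p j) (p (j + 1)) ⊆ U j) :
    τ.lengthIcc γ s t ≤ ∑ j ∈ Finset.range n, τ.separation (U j) (γ (p j)) (γ (p (j + 1))) :=
  iInf_le_of_le n (iInf_le_of_le p (iInf_le_of_le U (iInf_le_of_le h le_rfl)))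

lemma TimeOrientation.lengthIcc_self (τ : g.TimeOrientation) (γ : ℝ → M) (s : ℝ) :
    τ.lengthIcc γ s s = 0 := by
  have := τ.lengthIcc_le_sum (γ := γ) (s := s) (t := s) (n := 0) (p := fun _ ↦ s)
    (U := fun _ ↦ univ) ⟨monotone_const, rfl, rfl, by simp⟩
  simpa using this

lemma TimeOrientation.lengthIcc_le_separation (τ : g.TimeOrientation) {γ : ℝ → M} {s t : ℝ}
    (hst : s ≤ t) {U : Set M} (hU : IsOpen U) (hγ : γ '' Icc s t ⊆ U) :
    τ.lengthIcc γ s t ≤ τ.separation U (γ s) (γ t) := by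
  have := τ.lengthIcc_le_sum (γ := γ) (s := s) (t := t) (n := 1)
    (p := fun j ↦ if j = 0 then s else t) (U := fun _ ↦ U)
    ⟨monotone_nat_of_le_succ fun j ↦ by rcases j with _ | j <;> simp [hst], by simp, by simp,
      fun j hj ↦ by simpa [Nat.lt_one_iff.1 hj] using ⟨hU, image_subset_iff.1 hγ⟩⟩
  simpa using this

lemma TimeOrientation.lengthIcc_le_add (τ : g.TimeOrientation) (γ : ℝ → M) (s r t : ℝ) :
    τ.lengthIcc γ s t ≤ τ.lengthIcc γ s r + τ.lengthIcc γ r t := by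
  rw [lengthIcc, lengthIcc, lengthIcc]
  simp only [ENNReal.iInf_add, ENNReal.add_iInf]
  refine le_iInf fun n' ↦ le_iInf fun p' ↦ le_iInf fun U' ↦ le_iInf fun h' ↦
    le_iInf fun n ↦ le_iInf fun p ↦ le_iInf fun U ↦ le_iInf fun h ↦ ?_
  obtain ⟨hp, hp0, hpn, hU⟩ := h
  obtain ⟨hp', hp0', hpn', hU'⟩ := h'
  set P : ℕ → ℝ := fun j ↦ if j ≤ n then p j else p' (j - n) with hP
  set V : ℕ → Set M := fun j ↦ if j < n then U j else U' (j - n) with hV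
  have hP1 : ∀ j, j ≤ n → P j = p j := fun j hj ↦ by simp [hP, hj]
  have hP2 : ∀ j, P (n + j) = p' j := fun j ↦ by
    rcases j with _ | j
    · simp [hP, hpn, hp0']
    · simp [hP]
  have hV2 : ∀ j, V (n + j) = U' j := fun j ↦ by simp [hV]
  have hmono : Monotone P := by
    refine monotone_nat_of_le_succ fun j ↦ ?_
    rcases lt_or_ge j n with hj | hj
    · rw [hP1 j hj.le, hP1 (j + 1) hj]; exact hp (Nat.le_succ j)
    · obtain ⟨k, rfl⟩ := Nat.exists_eq_add_of_le hj
      rw [hP2, add_assoc, hP2]; exact hp' (Nat.le_succ k)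
  refine (τ.lengthIcc_le_sum (n := n + n') (p := P) (U := V)
    ⟨hmono, by rw [hP1 0 (Nat.zero_le _), hp0], by rw [hP2, hpn'], fun j hj ↦ ?_⟩).trans_eq ?_
  · rcases lt_or_ge j n with hjn | hjn
    · rw [hP1 j hjn.le, hP1 (j + 1) hjn]
      simpa [hV, hjn] using hU j hjn
    · obtain ⟨k, rfl⟩ := Nat.exists_eq_add_of_le hjn
      rw [hP2, add_assoc, hP2, hV2]
      exact hU' k (by omega)
  · rw [Finset.sum_range_add]
    congr 1
    · refine Finset.sum_congr rfl fun j hj ↦ ?_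
      have hjn := Finset.mem_range.1 hj
      rw [hP1 j hjn.le, hP1 (j + 1) hjn]
      simp [hV, hjn]
    · refine Finset.sum_congr rfl fun j _ ↦ ?_
      rw [hP2, add_assoc, hP2, hV2]

lemma TimeOrientation.length_mono (τ : g.TimeOrientation) (γ : ℝ → M) {I J : Set ℝ} (h : I ⊆ J) :
    τ.length γ I ≤ τ.length γ J :=
  iSup₂_le fun s hs ↦ iSup₂_le fun t ht ↦ iSup_le fun hst ↦
    le_iSup₂_of_le s (h hs) (le_iSup₂_of_le t (h ht) (le_iSup_of_le hst le_rfl))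

lemma TimeOrientation.lengthIcc_le_length (τ : g.TimeOrientation) (γ : ℝ → M) {J : Set ℝ}
    {s t : ℝ} (hs : s ∈ J) (ht : t ∈ J) (hst : s < t) : τ.lengthIcc γ s t ≤ τ.length γ J :=
  le_iSup₂_of_le s hs (le_iSup₂_of_le t ht (le_iSup_of_le hst le_rfl))

/-- Causal trips that are run through in their own direction if `future` is true, and backwards
otherwise. -/
def TimeOrientation.DirectedTrip (τ : g.TimeOrientation) (future : Bool) (U : Set M) (x y : M)
    (l : ℝ≥0∞) : Prop :=
  match future with
  | true => τ.Trip U x y l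
  | false => τ.Trip U y x l

section

variable {τ : g.TimeOrientation} {d : Bool} {U : Set M} {x y z : M} {l l' : ℝ≥0∞}

lemma TimeOrientation.DirectedTrip.refl (hx : x ∈ U) : τ.DirectedTrip d U x x 0 := by
  cases d <;> exact .refl x hx

lemma TimeOrientation.DirectedTrip.trans (h : τ.DirectedTrip d U x y l)
    (h' : τ.DirectedTrip d U y z l') : τ.DirectedTrip d U x z (l + l') := by
  cases d
  · rw [add_comm]; exact Trip.trans h' h
  · exact Trip.trans h h'

lemma TimeOrientation.DirectedTrip.mono {V : Set M} (hUV : U ⊆ V)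
    (h : τ.DirectedTrip d U x y l) : τ.DirectedTrip d V x y l := by
  cases d <;> exact Trip.mono hUV h

lemma TimeOrientation.directedTrip_or_iff (d : Bool) :
    τ.DirectedTrip d U x y l ∨ τ.DirectedTrip d U y x l ↔ τ.Trip U x y l ∨ τ.Trip U y x l := by
  cases d
  · exact or_comm
  · exact Iff.rfl

lemma TimeOrientation.DirectedTrip.le_separation (h : τ.DirectedTrip d U x y l) :
    l ≤ τ.separation U x y :=
  le_iSup₂_of_le l ((directedTrip_or_iff d).1 (.inl h)) le_rfl

/-- Between points in a causal chain `w`, `x`, `y`, `z`, the separation of the inner two is the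
smaller one, even if there are closed causal curves. -/
lemma TimeOrientation.separation_le_of_chain {w : M} {l₁ l₂ l₃ : ℝ≥0∞}
    (h₁ : τ.DirectedTrip d U w x l₁) (h₂ : τ.DirectedTrip d U x y l₂)
    (h₃ : τ.DirectedTrip d U y z l₃) : τ.separation U x y ≤ τ.separation U w z := by
  refine iSup₂_le fun l hl ↦ ?_
  rcases (directedTrip_or_iff d).2 hl with hl | hl
  · exact le_trans (by rw [add_right_comm]; exact le_add_self)
      ((h₁.trans hl).trans h₃).le_separation
  · refine le_trans ?_ ((((h₁.trans h₂).trans hl).trans h₂).trans h₃).le_separation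
    rw [add_right_comm _ l, add_right_comm _ l]; exact le_add_self

end

/-- `γ` is continuous on `J` and directed causal there, future directed if `future` is true. -/
def TimeOrientation.IsDirectedCurve (τ : g.TimeOrientation) (future : Bool) (γ : ℝ → M)
    (J : Set ℝ) : Prop :=
  ContinuousOn γ J ∧ ∀ s ∈ J, ∀ t ∈ J, s ≤ t → ∀ U : Set M, IsOpen U → γ '' Icc s t ⊆ U →
    ∃ l, τ.DirectedTrip future U (γ s) (γ t) l

lemma TimeOrientation.IsCausalCurve.exists_isDirectedCurve {τ : g.TimeOrientation} {γ : ℝ → M}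
    {J : Set ℝ} (h : τ.IsCausalCurve γ J) : ∃ d, τ.IsDirectedCurve d γ J := by
  rcases h with h | h
  · refine ⟨true, h.1, fun s hs t ht hst U hU hγ ↦ ?_⟩
    rcases hst.eq_or_lt with rfl | hst
    · exact ⟨0, .refl (hγ (mem_image_of_mem γ (by simp)))⟩
    · exact h.2 s hs t ht hst U hU hγ
  · refine ⟨false, h.1, fun s hs t ht hst U hU hγ ↦ ?_⟩
    rcases hst.eq_or_lt with rfl | hst
    · exact ⟨0, .refl (hγ (mem_image_of_mem γ (by simp)))⟩
    · exact h.2 s hs t ht hst U hU hγ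

lemma TimeOrientation.IsDirectedCurve.mono {τ : g.TimeOrientation} {d : Bool} {γ : ℝ → M}
    {I J : Set ℝ} (h : τ.IsDirectedCurve d γ J) (hIJ : I ⊆ J) : τ.IsDirectedCurve d γ I :=
  ⟨h.1.mono hIJ, fun s hs t ht ↦ h.2 s (hIJ hs) t (hIJ ht)⟩

/-- The length of a causal curve is monotone in the interval. -/
lemma TimeOrientation.IsDirectedCurve.lengthIcc_mono {τ : g.TimeOrientation} {d : Bool}
    {γ : ℝ → M} {s t : ℝ} (h : τ.IsDirectedCurve d γ (Icc s t)) {s' t' : ℝ} (hs : s ≤ s')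
    (hst : s' ≤ t') (ht : t' ≤ t) : τ.lengthIcc γ s' t' ≤ τ.lengthIcc γ s t := by
  refine le_iInf fun n ↦ le_iInf fun p ↦ le_iInf fun U ↦ le_iInf fun hp ↦ ?_
  obtain ⟨hp, hp0, hpn, hU⟩ := hp
  have key : ∀ k ≤ n, ∀ x y, s ≤ x → x ≤ y → y ≤ p k → τ.lengthIcc γ x y ≤
      ∑ j ∈ Finset.range k, τ.separation (U j) (γ (p j)) (γ (p (j + 1))) := by
    intro k
    induction k with
    | zero =>
      intro _ x y hx hxy hy
      have h1 : x = y := le_antisymm hxy (hy.trans (hp0.le.trans hx))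
      simp [h1, τ.lengthIcc_self]
    | succ k ih =>
      intro hk x y hx hxy hy
      rw [Finset.sum_range_succ]
      rcases le_or_gt y (p k) with hyk | hyk
      · exact (ih (by omega) x y hx hxy hyk).trans le_self_add
      have hsk : s ≤ p k := hp0 ▸ hp (Nat.zero_le k)
      have hkt : p (k + 1) ≤ t := hpn ▸ hp hk
      obtain ⟨hUo, hUk⟩ := hU k hk
      have hlast : ∀ z, p k ≤ z → z ≤ y →
          τ.lengthIcc γ z y ≤ τ.separation (U k) (γ (p k)) (γ (p (k + 1))) := by
        intro z hz hzy
        have hsub : ∀ a b, p k ≤ a → b ≤ p (k + 1) → γ '' Icc a b ⊆ U k := fun a b ha hb ↦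
          (image_mono (Icc_subset_Icc ha hb)).trans hUk
        have hd : ∀ a b, p k ≤ a → a ≤ b → b ≤ p (k + 1) →
            ∃ l, τ.DirectedTrip d (U k) (γ a) (γ b) l := fun a b ha hab hb ↦
          h.2 a ⟨by linarith, by linarith⟩ b ⟨by linarith, by linarith⟩ hab _ hUo (hsub a b ha hb)
        obtain ⟨l₁, h₁⟩ := hd (p k) z le_rfl hz (hzy.trans hy)
        obtain ⟨l₂, h₂⟩ := hd z y hz hzy hy
        obtain ⟨l₃, h₃⟩ := hd y (p (k + 1)) hyk.le hy le_rfl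
        exact (τ.lengthIcc_le_separation hzy hUo (hsub z y hz hy)).trans
          (separation_le_of_chain h₁ h₂ h₃)
      rcases le_or_gt x (p k) with hxk | hxk
      · exact (τ.lengthIcc_le_add γ x (p k) y).trans
          (add_le_add (ih (by omega) x (p k) hx hxk le_rfl) (hlast _ le_rfl hyk.le))
      · exact (hlast x hxk.le hxy).trans le_add_self
  exact key n le_rfl s' t' hs hst (hpn ▸ ht)

end Partition

/-! ### Upper semicontinuity on compact intervals -/

section Semicontinuity

variable {E : Type*} [NormedAddCommGroup E] [NormedSpace ℝ E]
  {M : Type*} [MetricSpace M] [ChartedSpace E M] [IsManifold 𝓘(ℝ, E) ∞ M]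
  {g : LorentzianMetric E M}

/-- A relation between the ends of intervals that is additive and holds for short intervals holds
for every compact interval. -/
lemma interval_induction {P : ℝ → ℝ → Prop} {s t : ℝ} (hst : s ≤ t)
    (htrans : ∀ u v w, s ≤ u → u ≤ v → v ≤ w → w ≤ t → P u v → P v w → P u w)
    (hloc : ∀ r ∈ Icc s t, ∃ W ∈ 𝓝 r, ∀ u v, s ≤ u → u ≤ v → v ≤ t → Icc u v ⊆ W → P u v) :
    P s t := by
  choose! W hW hP using hloc
  obtain ⟨p, hp0, hp, ⟨m, hm⟩, hpW⟩ := exists_monotone_Icc_subset_open_cover_Icc hst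
    (c := fun r : Icc s t ↦ Subtype.val ⁻¹' interior (W r))
    (fun r ↦ isOpen_interior.preimage continuous_subtype_val)
    (fun r _ ↦ mem_iUnion.2 ⟨r, mem_interior_iff_mem_nhds.2 (hW r r.2)⟩)
  have hstep : ∀ n, P (p n) (p (n + 1)) := by
    intro n
    obtain ⟨r, hr⟩ := hpW n
    refine hP r r.2 _ _ (p n).2.1 (hp (Nat.le_succ n)) (p (n + 1)).2.2 fun x hx ↦ ?_
    exact interior_subset (hr (a := ⟨x, (p n).2.1.trans hx.1, hx.2.trans (p (n + 1)).2.2⟩) hx)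
  have hall : ∀ n, P s (p (n + 1)) := by
    intro n
    induction n with
    | zero => simpa only [hp0] using hstep 0
    | succ n ih => exact htrans _ _ _ le_rfl (p _).2.1 (hp (Nat.le_succ _)) (p _).2.2 ih (hstep _)
  simpa only [hm (m + 1) (Nat.le_succ m)] using hall m

/-- Up to the error `δ` and arbitrarily small errors, the lengths of the curves `γ i` between `u`
and `v` are eventually bounded by the length of a causal trip in `U` that joins the corresponding
points of `γ'`. -/
def TimeOrientation.TripBound (τ : g.TimeOrientation) (d : Bool) (γ : ℕ → ℝ → M) (γ' : ℝ → M)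
    (U : Set M) (δ : ℝ≥0∞) (u v : ℝ) : Prop :=
  ∀ η : ℝ≥0, 0 < η → ∃ l, τ.DirectedTrip d U (γ' u) (γ' v) l ∧
    ∀ᶠ i in atTop, τ.lengthIcc (γ i) u v ≤ l + δ + η

variable {τ : g.TimeOrientation} {d : Bool} {γ : ℕ → ℝ → M} {γ' : ℝ → M}

lemma TimeOrientation.TripBound.trans {U : Set M} {δ δ' : ℝ≥0∞} {u v w : ℝ}
    (h : τ.TripBound d γ γ' U δ u v) (h' : τ.TripBound d γ γ' U δ' v w) :
    τ.TripBound d γ γ' U (δ + δ') u w := by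
  intro η hη
  obtain ⟨l, hl, hi⟩ := h (η / 2) (half_pos hη)
  obtain ⟨l', hl', hi'⟩ := h' (η / 2) (half_pos hη)
  refine ⟨l + l', hl.trans hl', ?_⟩
  filter_upwards [hi, hi'] with i h1 h2
  refine (τ.lengthIcc_le_add (γ i) u v w).trans ((add_le_add h1 h2).trans_eq ?_)
  have : (η : ℝ≥0∞) = ((η / 2 : ℝ≥0) : ℝ≥0∞) + ((η / 2 : ℝ≥0) : ℝ≥0∞) := by
    rw [← ENNReal.coe_add, add_halves]
  rw [this]; ring

/-- The local comparison for trips that are run through in a given direction. -/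
lemma TimeOrientation.exists_directed_local_comparison [FiniteDimensional ℝ E]
    (τ : g.TimeOrientation) (d : Bool) (x₀ : M) :
    ∃ R, IsOpen R ∧ x₀ ∈ R ∧ ∃ h : M → ℝ, (∀ x y l, τ.DirectedTrip d R x y l → h x ≤ h y) ∧
      ∀ z ∈ R, ∀ ε > 0, ∀ V ∈ 𝓝 z, ∃ B, IsOpen B ∧ z ∈ B ∧ B ⊆ V ∧ B ⊆ R ∧ ∃ n : M → M → ℝ,
        ContinuousOn (Function.uncurry n) (B ×ˢ B) ∧
        (∀ x y, τ.separation B x y ≤ ENNReal.ofReal (n x y)) ∧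
        ∀ x y l, τ.DirectedTrip d B x y l → ∃ l', τ.DirectedTrip d B x y l' ∧
          ENNReal.ofReal (n x y) ≤ l' + ENNReal.ofReal (ε * (h y - h x)) := by
  obtain ⟨R, hRo, hxR, h, hh, hR⟩ := τ.exists_local_comparison x₀
  cases d
  · refine ⟨R, hRo, hxR, fun x ↦ -h x, fun x y l hl ↦ neg_le_neg (hh y x l hl), ?_⟩
    intro z hz ε hε V hV
    obtain ⟨B, hBo, hzB, hBV, hBR, n, hn, hsymm, hsep, hB⟩ := hR z hz ε hε V hV
    refine ⟨B, hBo, hzB, hBV, hBR, n, hn, hsep, fun x y l hl ↦ ?_⟩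
    obtain ⟨l', hl', hle⟩ := hB y x l hl
    refine ⟨l', hl', ?_⟩
    rwa [hsymm, neg_sub_neg]
  · refine ⟨R, hRo, hxR, h, hh, fun z hz ε hε V hV ↦ ?_⟩
    obtain ⟨B, hBo, hzB, hBV, hBR, n, hn, -, hsep, hB⟩ := hR z hz ε hε V hV
    exact ⟨B, hBo, hzB, hBV, hBR, n, hn, hsep, hB⟩

lemma exists_mem_nhds_image_subset {s t r : ℝ} (hγ' : ContinuousOn γ' (Icc s t))
    (hr : r ∈ Icc s t) {B : Set M} (hB : IsOpen B) (hrB : γ' r ∈ B) :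
    ∃ W ∈ 𝓝 r, ∀ u v, s ≤ u → v ≤ t → Icc u v ⊆ W → γ' '' Icc u v ⊆ B := by
  obtain ⟨W, hW, hWB⟩ := mem_nhdsWithin_iff_exists_mem_nhds_inter.1
    ((hγ' r hr).preimage_mem_nhdsWithin (hB.mem_nhds hrB))
  refine ⟨W, hW, fun u v hu hv huv ↦ image_subset_iff.2 fun x hx ↦ ?_⟩
  exact hWB ⟨huv hx, hu.trans hx.1, hx.2.trans hv⟩

lemma eventually_image_subset {K : Set ℝ} (hγ' : ContinuousOn γ' K) (hK : IsCompact K)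
    (hconv : TendstoUniformlyOn γ γ' atTop K) {B : Set M} (hB : IsOpen B) (hKB : γ' '' K ⊆ B) :
    ∀ᶠ i in atTop, γ i '' K ⊆ B := by
  obtain ⟨δ, hδ, hδB⟩ := (hK.image_of_continuousOn hγ').exists_thickening_subset_open hB hKB
  filter_upwards [Metric.tendstoUniformlyOn_iff.1 hconv δ hδ] with i hi
  refine image_subset_iff.2 fun x hx ↦ hδB ?_
  exact Metric.mem_thickening_iff.2 ⟨γ' x, mem_image_of_mem γ' hx, by
    rw [dist_comm]; exact hi x hx⟩

/-- On short pieces of the limit curve, the separation in a small neighbourhood bounds the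
lengths; it is compared with a trip along the limit curve by the local comparison. -/
lemma TimeOrientation.IsDirectedCurve.tripBound_of_local {s t : ℝ}
    (hγ' : τ.IsDirectedCurve d γ' (Icc s t))
    (hconv : TendstoUniformlyOn γ γ' atTop (Icc s t)) {U : Set M}
    {B : Set M} (hBo : IsOpen B) (hBU : B ⊆ U) {n : M → M → ℝ} {h : M → ℝ} {ε : ℝ}
    (hn : ContinuousOn (Function.uncurry n) (B ×ˢ B))
    (hsep : ∀ x y, τ.separation B x y ≤ ENNReal.ofReal (n x y))
    (hB : ∀ x y l, τ.DirectedTrip d B x y l → ∃ l', τ.DirectedTrip d B x y l' ∧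
          ENNReal.ofReal (n x y) ≤ l' + ENNReal.ofReal (ε * (h y - h x)))
    {u v : ℝ} (hu : s ≤ u) (huv : u ≤ v) (hv : v ≤ t) (huvB : γ' '' Icc u v ⊆ B) :
    τ.TripBound d γ γ' U (ENNReal.ofReal (ε * (h (γ' v) - h (γ' u)))) u v := by
  intro η hη
  have hus : u ∈ Icc s t := ⟨hu, huv.trans hv⟩
  have hvs : v ∈ Icc s t := ⟨hu.trans huv, hv⟩
  have huB : γ' u ∈ B := huvB (mem_image_of_mem γ' ⟨le_rfl, huv⟩)
  have hvB : γ' v ∈ B := huvB (mem_image_of_mem γ' ⟨huv, le_rfl⟩)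
  obtain ⟨l₀, hl₀⟩ := hγ'.2 u hus v hvs huv B hBo huvB
  obtain ⟨l, hl, hle⟩ := hB _ _ _ hl₀
  refine ⟨l, hl.mono hBU, ?_⟩
  have hsub : Icc u v ⊆ Icc s t := Icc_subset_Icc hu hv
  have h1 := eventually_image_subset (hγ'.1.mono hsub) isCompact_Icc (hconv.mono hsub) hBo huvB
  have h2 : Tendsto (fun i ↦ n (γ i u) (γ i v)) atTop (𝓝 (n (γ' u) (γ' v))) := by
    have h3 : ContinuousAt (Function.uncurry n) (γ' u, γ' v) :=
      hn.continuousAt ((hBo.prod hBo).mem_nhds ⟨huB, hvB⟩)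
    exact h3.tendsto.comp ((hconv.tendsto_at hus).prodMk_nhds (hconv.tendsto_at hvs))
  have h3 := h2.eventually_le_const (show n (γ' u) (γ' v) < n (γ' u) (γ' v) + η by
    have : (0 : ℝ) < η := hη
    linarith)
  filter_upwards [h1, h3] with i hi1 hi2
  calc τ.lengthIcc (γ i) u v ≤ τ.separation B (γ i u) (γ i v) :=
        τ.lengthIcc_le_separation huv hBo hi1
    _ ≤ ENNReal.ofReal (n (γ i u) (γ i v)) := hsep _ _
    _ ≤ ENNReal.ofReal (n (γ' u) (γ' v) + η) := ENNReal.ofReal_le_ofReal hi2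
    _ ≤ ENNReal.ofReal (n (γ' u) (γ' v)) + ENNReal.ofReal η := ENNReal.ofReal_add_le
    _ ≤ _ := by rw [ENNReal.ofReal_coe_nnreal]; gcongr

variable [FiniteDimensional ℝ E]

/-- The errors of the local comparison are controlled by a time function on each of finitely many
regions, hence they vanish in the limit of fine partitions. -/
lemma TimeOrientation.IsDirectedCurve.tripBound {s t : ℝ} (hst : s ≤ t)
    (hγ' : τ.IsDirectedCurve d γ' (Icc s t))
    (hconv : TendstoUniformlyOn γ γ' atTop (Icc s t)) {U : Set M} (hU : IsOpen U)
    (hγU : γ' '' Icc s t ⊆ U) : τ.TripBound d γ γ' U 0 s t := by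
  refine interval_induction (P := τ.TripBound d γ γ' U 0) hst
    (fun u v w _ _ _ _ h1 h2 ↦ by simpa using h1.trans h2) fun r hr ↦ ?_
  obtain ⟨R, hRo, hrR, h, hh, hR⟩ := τ.exists_directed_local_comparison d (γ' r)
  have hrU : γ' r ∈ U := hγU (mem_image_of_mem γ' hr)
  obtain ⟨W, hW, hWR⟩ := exists_mem_nhds_image_subset hγ'.1 hr (hRo.inter hU) ⟨hrR, hrU⟩
  refine ⟨W, hW, fun s' t' hs hst' ht hWst ↦ ?_⟩
  have hsubR := hWR s' t' hs ht hWst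
  have hcurve := hγ'.mono (Icc_subset_Icc hs ht)
  have hconv' := hconv.mono (Icc_subset_Icc hs ht)
  have hε : ∀ ε > 0, τ.TripBound d γ γ' (R ∩ U)
      (ENNReal.ofReal (ε * (h (γ' t') - h (γ' s')))) s' t' := by
    intro ε hε
    refine interval_induction (P := fun u v ↦ τ.TripBound d γ γ' (R ∩ U)
      (ENNReal.ofReal (ε * (h (γ' v) - h (γ' u)))) u v) hst' ?_ fun r' hr' ↦ ?_
    · intro u v w _ _ _ _ h1 h2
      obtain ⟨l₁, hl₁, -⟩ := h1 1 one_pos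
      obtain ⟨l₂, hl₂, -⟩ := h2 1 one_pos
      have h3 := hh _ _ _ (hl₁.mono inter_subset_left)
      have h4 := hh _ _ _ (hl₂.mono inter_subset_left)
      have h5 := h1.trans h2
      rw [← ENNReal.ofReal_add (mul_nonneg hε.le (sub_nonneg.2 h3))
        (mul_nonneg hε.le (sub_nonneg.2 h4)), ← mul_add, sub_add_sub_cancel'] at h5
      exact h5
    · have hrRU := hsubR (mem_image_of_mem γ' hr')
      obtain ⟨B, hBo, hrB, hBV, -, n, hn, hsep, hB⟩ :=
        hR (γ' r') hrRU.1 ε hε (R ∩ U) ((hRo.inter hU).mem_nhds hrRU)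
      obtain ⟨W', hW', hWB⟩ := exists_mem_nhds_image_subset hcurve.1 hr' hBo hrB
      exact ⟨W', hW', fun u v hu huv hv huvW ↦ hcurve.tripBound_of_local hconv'
        hBo hBV hn hsep hB hu huv hv (hWB u v hu hv huvW)⟩
  intro η hη
  have hη' : (0 : ℝ) < η := hη
  set H := |h (γ' t') - h (γ' s')| + 1 with hH
  have hH0 : 0 < H := by positivity
  obtain ⟨l, hl, hi⟩ := hε (η / 2 / H) (by positivity) (η / 2) (half_pos hη)
  refine ⟨l, hl.mono inter_subset_right, hi.mono fun i hi ↦ hi.trans ?_⟩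
  have h1 : ENNReal.ofReal (η / 2 / H * (h (γ' t') - h (γ' s'))) ≤ ((η / 2 : ℝ≥0) : ℝ≥0∞) := by
    rw [← ENNReal.ofReal_coe_nnreal]
    refine ENNReal.ofReal_le_ofReal ?_
    push_cast
    calc (η : ℝ) / 2 / H * (h (γ' t') - h (γ' s')) ≤ η / 2 / H * H := by
          gcongr
          rw [hH]
          linarith [le_abs_self (h (γ' t') - h (γ' s'))]
      _ = η / 2 := by field_simp
  calc _ ≤ l + ((η / 2 : ℝ≥0) : ℝ≥0∞) + ((η / 2 : ℝ≥0) : ℝ≥0∞) := by gcongr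
    _ = l + 0 + η := by rw [add_assoc, ← ENNReal.coe_add, add_halves, add_zero]

/-- The length is upper semicontinuous under uniform convergence on compact intervals. -/
lemma TimeOrientation.IsDirectedCurve.limsup_lengthIcc_le {s t : ℝ}
    (hγ' : τ.IsDirectedCurve d γ' (Icc s t))
    (hconv : TendstoUniformlyOn γ γ' atTop (Icc s t)) :
    limsup (fun i ↦ τ.lengthIcc (γ i) s t) atTop ≤ τ.lengthIcc γ' s t := by
  refine le_iInf fun n ↦ le_iInf fun p ↦ le_iInf fun U ↦ le_iInf fun hp ↦ ?_
  obtain ⟨hp, hp0, hpn, hU⟩ := hp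
  have key : ∀ k ≤ n, ∀ η : ℝ≥0, 0 < η → ∀ᶠ i in atTop, τ.lengthIcc (γ i) s (p k) ≤
      ∑ j ∈ Finset.range k, τ.separation (U j) (γ' (p j)) (γ' (p (j + 1))) + η := by
    intro k
    induction k with
    | zero => intro _ η _; simp [hp0, τ.lengthIcc_self]
    | succ k ih =>
      intro hk η hη
      have hsub : Icc (p k) (p (k + 1)) ⊆ Icc s t :=
        Icc_subset_Icc (hp0 ▸ hp (Nat.zero_le k)) (hpn ▸ hp hk)
      obtain ⟨l, hl, hi⟩ := (hγ'.mono hsub).tripBound (hp (Nat.le_succ k)) (hconv.mono hsub)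
        (hU k hk).1 (hU k hk).2 (η / 2) (half_pos hη)
      filter_upwards [ih (by omega) (η / 2) (half_pos hη), hi] with i h1 h2
      rw [Finset.sum_range_succ]
      refine (τ.lengthIcc_le_add (γ i) s (p k) (p (k + 1))).trans ((add_le_add h1 h2).trans ?_)
      have h3 : (η : ℝ≥0∞) = ((η / 2 : ℝ≥0) : ℝ≥0∞) + ((η / 2 : ℝ≥0) : ℝ≥0∞) := by
        rw [← ENNReal.coe_add, add_halves]
      rw [h3, add_zero, add_add_add_comm]
      gcongr
      exact hl.le_separation
  refine ENNReal.le_of_forall_pos_le_add fun η hη _ ↦ limsup_le_of_le (by isBoundedDefault) ?_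
  simpa only [hpn] using key n le_rfl η hη

end Semicontinuity

/-! ### Half open intervals -/

section Tail

variable {E : Type*} [NormedAddCommGroup E] [NormedSpace ℝ E]
  {M : Type*} [MetricSpace M] [ChartedSpace E M] [IsManifold 𝓘(ℝ, E) ∞ M]
  {g : LorentzianMetric E M} {τ : g.TimeOrientation}

lemma TimeOrientation.IsCausalCurve.length_Ico_le_add {γ : ℝ → M} {a r : ℝ}
    (hγ : τ.IsCausalCurve γ (Ico 0 a)) (hr : r ∈ Ico 0 a) :
    τ.length γ (Ico 0 a) ≤ τ.lengthIcc γ 0 r + τ.length γ (Ico r a) := by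
  obtain ⟨d, hd⟩ := hγ.exists_isDirectedCurve
  refine iSup₂_le fun s hs ↦ iSup₂_le fun t ht ↦ iSup_le fun hst ↦ ?_
  have h1 : τ.lengthIcc γ s t ≤ τ.lengthIcc γ 0 (max t r) :=
    (hd.mono fun x hx ↦ ⟨hx.1, hx.2.trans_lt (max_lt ht.2 hr.2)⟩).lengthIcc_mono hs.1 hst.le
      (le_max_left t r)
  refine h1.trans ((τ.lengthIcc_le_add γ 0 r _).trans (add_le_add le_rfl ?_))
  rcases le_or_gt t r with htr | htr
  · simp [max_eq_right htr, τ.lengthIcc_self]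
  · rw [max_eq_left htr.le]
    exact τ.lengthIcc_le_length γ ⟨le_rfl, hr.2⟩ ⟨htr.le, ht.2⟩ htr

/-- A uniform bound for the lengths near the open end extends the upper semicontinuity from
compact intervals to the half open one. -/
lemma TimeOrientation.limsup_length_Ico_le [FiniteDimensional ℝ E] {a : ℝ} (ha : 0 < a)
    {γ : ℕ → ℝ → M} (hγ : ∀ i, τ.IsCausalCurve (γ i) (Ico 0 a)) {γ' : ℝ → M}
    (hγ' : τ.IsCausalCurve γ' (Ico 0 a))
    (hconv : ∀ K ⊆ Ico 0 a, IsCompact K → TendstoUniformlyOn γ γ' atTop K) {b : ℝ} (hb : 0 < b)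
    (htail : ∀ i, ∀ r ∈ Ico 0 a, τ.length (γ i) (Ico r a) ≤ ENNReal.ofReal (b * |a - r|)) :
    limsup (fun i ↦ τ.length (γ i) (Ico 0 a)) atTop ≤ τ.length γ' (Ico 0 a) := by
  obtain ⟨d, hd⟩ := hγ'.exists_isDirectedCurve
  refine ENNReal.le_of_forall_pos_le_add fun η hη _ ↦ limsup_le_of_le (by isBoundedDefault) ?_
  have hη' : (0 : ℝ) < η := hη
  -- beyond `a - δ` the lengths are at most `η / 2`
  set δ := min (a / 2) (η / 2 / b) with hδ
  have hδ0 : 0 < δ := by positivity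
  have hδa : δ ≤ a / 2 := min_le_left _ _
  have hr : a - δ ∈ Ico 0 a := ⟨by linarith, by linarith⟩
  have hsub : Icc 0 (a - δ) ⊆ Ico 0 a := fun x hx ↦ ⟨hx.1, hx.2.trans_lt hr.2⟩
  have h1 := (hd.mono hsub).limsup_lengthIcc_le (hconv _ hsub isCompact_Icc)
  have h2 : limsup (fun i ↦ τ.lengthIcc (γ i) 0 (a - δ)) atTop ≤ τ.length γ' (Ico 0 a) :=
    h1.trans (τ.lengthIcc_le_length γ' ⟨le_rfl, ha⟩ hr (by linarith))
  have h3 : ∀ᶠ i in atTop, τ.lengthIcc (γ i) 0 (a - δ) ≤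
      τ.length γ' (Ico 0 a) + ((η / 2 : ℝ≥0) : ℝ≥0∞) := by
    rcases eq_or_ne (τ.length γ' (Ico 0 a)) ⊤ with htop | htop
    · simp [htop]
    · have h4 : limsup (fun i ↦ τ.lengthIcc (γ i) 0 (a - δ)) atTop <
          τ.length γ' (Ico 0 a) + ((η / 2 : ℝ≥0) : ℝ≥0∞) :=
        h2.trans_lt (ENNReal.lt_add_right htop (by simpa using hη.ne'))
      exact (eventually_lt_of_limsup_lt h4).mono fun i hi ↦ hi.le
  filter_upwards [h3] with i hi
  have h5 : τ.length (γ i) (Ico (a - δ) a) ≤ ((η / 2 : ℝ≥0) : ℝ≥0∞) := by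
    refine (htail i _ hr).trans ?_
    rw [← ENNReal.ofReal_coe_nnreal]
    refine ENNReal.ofReal_le_ofReal ?_
    rw [sub_sub_cancel, abs_of_pos hδ0]
    push_cast
    calc b * δ ≤ b * (η / 2 / b) := by gcongr; exact min_le_right _ _
      _ = η / 2 := by field_simp
  calc _ ≤ _ := (hγ i).length_Ico_le_add hr
    _ ≤ _ := add_le_add hi h5
    _ = _ := by rw [add_assoc, ← ENNReal.coe_add, add_halves]

/-- If the lengths converge on the compact intervals, then the length of the limit curve is at
most the lower limit of the lengths. -/
lemma TimeOrientation.length_Ico_le_liminf {a : ℝ} {γ : ℕ → ℝ → M} {γ' : ℝ → M}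
    (h : ∀ t ∈ Ico 0 a, Tendsto (fun i ↦ τ.length (γ i) (Icc 0 t)) atTop
      (𝓝 (τ.length γ' (Icc 0 t)))) :
    τ.length γ' (Ico 0 a) ≤ liminf (fun i ↦ τ.length (γ i) (Ico 0 a)) atTop := by
  refine iSup₂_le fun s hs ↦ iSup₂_le fun t ht ↦ iSup_le fun hst ↦ ?_
  calc τ.lengthIcc γ' s t ≤ τ.length γ' (Icc 0 t) :=
        τ.lengthIcc_le_length γ' ⟨hs.1, hst.le⟩ ⟨ht.1, le_rfl⟩ hst
    _ = liminf (fun i ↦ τ.length (γ i) (Icc 0 t)) atTop := (h t ht).liminf_eq.symm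
    _ ≤ _ := liminf_le_liminf (Eventually.of_forall fun i ↦
        τ.length_mono (γ i) (Icc_subset_Ico_right ht.2))

end Tail

end LorentzianMetric

theorem mainTheorem3 {E : Type*} [NormedAddCommGroup E] [NormedSpace ℝ E] [FiniteDimensional ℝ E]
    {M : Type*} [MetricSpace M] [ChartedSpace E M] [IsManifold 𝓘(ℝ, E) ∞ M]
    (g : LorentzianMetric E M) (τ : g.TimeOrientation)
    {a : ℝ} (ha : 0 < a)
    (γ : ℕ → ℝ → M) (hγ : ∀ i, τ.IsCausalCurve (γ i) (Ico 0 a))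
    (γ' : ℝ → M) (hγ' : τ.IsCausalCurve γ' (Ico 0 a))
    (hconv : ∀ K ⊆ Ico 0 a, IsCompact K → TendstoUniformlyOn γ γ' atTop K)
    (hbdd : ∃ C : ℝ, ∀ i, τ.length (γ i) (Ico 0 a) ≤ ENNReal.ofReal C)
    (hlip : ∃ b : ℝ, 0 < b ∧ ∀ i,
      (∀ t₁ ∈ Ico 0 a, ∀ t₂ ∈ Ico 0 a,
        τ.length (γ i) (Icc t₁ t₂) ≤ ENNReal.ofReal (b * |t₂ - t₁|)) ∧
      ∀ t₁ ∈ Ico 0 a, τ.length (γ i) (Ico t₁ a) ≤ ENNReal.ofReal (b * |a - t₁|)) :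
    (∃ φ : ℕ → ℕ, StrictMono φ ∧
      limsup (fun k ↦ τ.length (γ (φ k)) (Ico 0 a)) atTop ≤ τ.length γ' (Ico 0 a)) ∧
    ∀ φ : ℕ → ℕ, StrictMono φ →
      limsup (fun k ↦ τ.length (γ (φ k)) (Ico 0 a)) atTop ≤ τ.length γ' (Ico 0 a) →
      (∀ t ∈ Ico 0 a, Tendsto (fun k ↦ τ.length (γ (φ k)) (Icc 0 t)) atTop
        (𝓝 (τ.length γ' (Icc 0 t)))) →
      Tendsto (fun k ↦ τ.length (γ (φ k)) (Ico 0 a)) atTop (𝓝 (τ.length γ' (Ico 0 a))) := by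
  obtain ⟨b, hb, hlip⟩ := hlip
  refine ⟨⟨id, strictMono_id, ?_⟩, fun φ _ hsup hlim ↦ ?_⟩
  · exact LorentzianMetric.TimeOrientation.limsup_length_Ico_le ha hγ hγ' hconv hb
      fun i ↦ (hlip i).2
  · exact tendsto_of_le_liminf_of_limsup_le
      (LorentzianMetric.TimeOrientation.length_Ico_le_liminf hlim) hsup
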